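/- **Lemma 3.1 [Azumaya probe to conifold singularity].** Let $R=\mathbb{C}[z_1,z_2,z_3,z_4]/(z_1z_2-z_3z_4)$ and let $Y=\mathrm{Spec}\,R$ be the conifold. Let $\pi:\widetilde{Y}\to Y$, $\pi_+:Y_+\to Y$ and $\pi_-:Y_-\to Y$ be the blow-ups of $Y$ along $V(I)$ for $I=(z_1,z_2,z_3,z_4)$, $I=(z_1,z_3)$ and $I=(z_1,z_4)$ respectively, i.e. $\mathrm{Proj}\big(\bigoplus_{n\ge 0}I^n\big)\to Y$. Let $\mathrm{Rep}=\mathrm{Rep}(R,M_2(\mathbb{C}))$ be the scheme of representations $\rho:R\to M_2(\mathbb{C})$, on which $GL_2(\mathbb{C})$ acts by conjugation, and let $W_{ut}\subset\mathrm{Rep}$ be the closed subscheme of those $\rho$ for which every $\rho(z_i)$ has the form $\begin{pmatrix}a_i&\varepsilon_i\\0&a_i\end{pmatrix}$. Let $W\subset\mathrm{Rep}$ be the scheme-theoretic image of the morphism $GL_2(\mathbb{C})\times W_{ut}\to\mathrm{Rep}$, $(g,\rho)\mapsto g\rho g^{-1}$ (it parametrizes the rank-2 D0-branes on $Y$ whose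 reduced image is a single point), and let $\pi^W:W\to Y$ be the morphism given by $z_i\mapsto\frac12\mathrm{Tr}\,\rho(z_i)$. Then there exist unique morphisms $f_\pm:\widetilde{Y}\to Y_\pm$ with $\pi_\pm\circ f_\pm=\pi$, and there exist $GL_2(\mathbb{C})$-invariant (locally closed) subschemes $\widetilde{Y}'$, $Y_+'$, $Y_-'$ of $W$ such that: 1. the geometric quotients $\widetilde{Y}'/GL_2(\mathbb{C})$, $Y_+'/GL_2(\mathbb{C})$, $Y_-'/GL_2(\mathbb{C})$ (in the sense of Mumford) exist; 2. the restrictions of $\pi^W$ to $\widetilde{Y}'$, $Y_+'$, $Y_-'$ descend uniquely to morphisms from these quotients to $Y$; 3. there are isomorphisms $\widetilde{Y}'/GL_2(\mathbb{C})\cong\widetilde{Y}$, $Y_+'/GL_2(\mathbb{C})\cong Y_+$, $Y_-'/GL_2(\mathbb{C})\cong Y_-$ under which the descended morphisms are $\pi$, $\pi_+$, $\pi_-$; consequently, transporting $f_\pm$ through these isomorphisms, the three quotients with their descended morphisms to $Y$ form the resolution diagram $\widetilde{Y}\xrightarrow{f_\pm}Y_\pm\xrightarrow{\pi_\pm}Y$,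 $\pi_\pm\circ f_\pm=\pi$. -/

import Mathlib

open AlgebraicGeometry CategoryTheory CategoryTheory.Limits
open scoped TensorProduct Polynomial

noncomputable section

/-! ### Blow-ups of affine schemes -/

namespace BlowUp

variable {R : Type} [CommRing R]

/-- The degree `n` piece `I ^ n` (realised as `I ^ n * t ^ n`) of the Rees algebra
`⨁ I ^ n ⊆ R[t]`. -/
def reesPiece (I : Ideal R) (n : ℕ) : Submodule R (reesAlgebra I) :=
  (LinearMap.range (Polynomial.monomial n : R →ₗ[R] R[X])).comap
    (reesAlgebra I).val.toLinearMap

theorem mem_reesPiece {I : Ideal R} {n : ℕ} {x : reesAlgebra I} :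
    x ∈ reesPiece I n ↔ ∃ r : R, Polynomial.monomial n r = (x : R[X]) := Iff.rfl

/-- The homogeneous component of degree `n` of an element of the Rees algebra. -/
def reesComponent (I : Ideal R) (x : reesAlgebra I) (n : ℕ) : reesPiece I n :=
  ⟨⟨Polynomial.monomial n ((x : R[X]).coeff n),
    reesAlgebra.monomial_mem.2 ((mem_reesAlgebra_iff I _).1 x.2 n)⟩, ⟨_, rfl⟩⟩

instance reesGradedMonoid (I : Ideal R) : SetLike.GradedMonoid (reesPiece I) where
  one_mem := ⟨1, rfl⟩
  mul_mem := by
    rintro i j x y ⟨r, hr⟩ ⟨s, hs⟩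
    refine ⟨r * s, ?_⟩
    rw [← Polynomial.monomial_mul_monomial, hr, hs]
    rfl

theorem reesMk_eq_sum (I : Ideal R) (x : reesAlgebra I) (s : Finset ℕ) :
    DirectSum.mk (fun n => reesPiece I n) s (fun n => reesComponent I x n) =
      ∑ n ∈ s, DirectSum.of (fun n => reesPiece I n) n (reesComponent I x n) := by
  classical
  refine DFinsupp.ext fun m => ?_
  rw [DFinsupp.finsetSum_apply]
  by_cases h : m ∈ s
  · rw [Finset.sum_eq_single m]
    · exact (DirectSum.mk_apply_of_mem h).trans (DirectSum.of_eq_same (β := fun n => reesPiece I n) m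
        (reesComponent I x m)).symm
    · intro b _ hb
      exact DirectSum.of_eq_of_ne b m _ hb.symm
    · exact fun h' => absurd h h'
  · rw [Finset.sum_eq_zero]
    · exact DirectSum.mk_apply_of_notMem h
    · intro b hb
      exact DirectSum.of_eq_of_ne b m _ (fun e => h (e ▸ hb))

theorem reesMk_apply (I : Ideal R) (x : reesAlgebra I) (n : ℕ) :
    DirectSum.mk (fun n => reesPiece I n) (x : R[X]).support (fun n => reesComponent I x n) n =
      reesComponent I x n := by
  classical
  by_cases h : n ∈ (x : R[X]).support
  · exact DirectSum.mk_apply_of_mem h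
  · rw [DirectSum.mk_apply_of_notMem h]
    apply Subtype.ext
    apply Subtype.ext
    change 0 = Polynomial.monomial n ((x : R[X]).coeff n)
    rw [Polynomial.notMem_support_iff.1 h, map_zero]

instance reesDecomposition (I : Ideal R) : DirectSum.Decomposition (reesPiece I) where
  decompose' x := DirectSum.mk (fun n => reesPiece I n) (x : R[X]).support
    (fun n => reesComponent I x n)
  left_inv x := by
    classical
    have h : (x : R[X]) = ∑ n ∈ (x : R[X]).support, Polynomial.monomial n ((x : R[X]).coeff n) :=
      Polynomial.as_sum_support _
    refine (congrArg _ (reesMk_eq_sum I x _)).trans ?_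
    rw [map_sum]
    apply Subtype.ext
    simp only [DirectSum.coeAddMonoidHom_of, AddSubmonoidClass.coe_finsetSum]
    exact h.symm
  right_inv x := by
    classical
    refine DFinsupp.ext fun n => ?_
    apply Subtype.ext
    apply Subtype.ext
    rw [reesMk_apply]
    change Polynomial.monomial n (((DirectSum.coeAddMonoidHom (reesPiece I) x : reesAlgebra I) :
      R[X]).coeff n) = _
    induction x using DirectSum.induction_on with
    | zero => simp
    | of i y =>
      obtain ⟨y, r, hr⟩ := y
      change Polynomial.monomial i r = (y : R[X]) at hr
      rw [DirectSum.coeAddMonoidHom_of, DirectSum.coe_of_apply]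
      simp only [← hr, Polynomial.coeff_monomial]
      split_ifs with h
      · subst h; exact hr
      · simp
    | add x y hx hy =>
      rw [map_add]
      change Polynomial.monomial n ((_ + _ : R[X]).coeff n) = _ + _
      rw [Polynomial.coeff_add, map_add, hx, hy]

instance reesGradedAlgebra (I : Ideal R) : GradedAlgebra (reesPiece I) where

/-- The blow-up of `Spec R` along `V(I)`: the scheme `Proj (⨁ I ^ n)`. -/
def blowUp (I : Ideal R) : Scheme.{0} := Proj (reesPiece I)

/-- The structure morphism `Proj (⨁ I ^ n) ⟶ Spec R` of the blow-up. -/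
def blowUpπ (I : Ideal R) : blowUp I ⟶ Spec (.of R) :=
  Proj.toSpecZero (reesPiece I) ≫
    Spec.map (CommRingCat.ofHom (algebraMap R (reesPiece I 0)))

end BlowUp

/-! ### Geometric quotients -/

/-- Let `x : X ⟶ S` be a scheme over `S`, with an action `σ : G ×_S X ⟶ X` of a group scheme
`g : G ⟶ S`. The morphism `φ : X ⟶ Q` over `S` is a *geometric quotient* (Mumford) if
it is constant on orbits, surjective, its geometric fibres are exactly the orbits (the map
`(σ, pr₂) : G ×_S X ⟶ X ×_Q X` is surjective), it is submersive, and the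
functions on `Q` are exactly the invariant functions on `X`. -/
structure IsGeometricQuotient {S G X Q : Scheme.{0}} (g : G ⟶ S) (x : X ⟶ S) (y : Q ⟶ S)
    (σ : pullback g x ⟶ X) (φ : X ⟶ Q) : Prop where
  comp_str : φ ≫ y = x
  invariant : σ ≫ φ = pullback.snd g x ≫ φ
  surjective : Surjective φ
  orbits : Surjective (pullback.lift σ (pullback.snd g x) invariant : pullback g x ⟶ pullback φ φ)
  submersive : ∀ U : Set Q, IsOpen (φ ⁻¹' U) ↔ IsOpen U
  functions_injective : ∀ U : Q.Opens, Function.Injective (φ.app U)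
  functions : ∀ (U : Q.Opens) (s : Γ(X, φ ⁻¹ᵁ U)),
    (∃ t : Γ(Q, U), φ.app U t = s) ↔
      σ.appLE (φ ⁻¹ᵁ U) (pullback.snd g x ⁻¹ᵁ φ ⁻¹ᵁ U)
          (by rw [← Scheme.Hom.comp_preimage, ← Scheme.Hom.comp_preimage, invariant]) s =
        (pullback.snd g x).app (φ ⁻¹ᵁ U) s

namespace Conifold

/-! ### The conifold and its resolutions

The coordinates `z₁, z₂, z₃, z₄` have the indices `0, 1, 2, 3`. -/

/-- The equation `z₁ z₂ - z₃ z₄`. -/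
def equation : MvPolynomial (Fin 4) ℂ :=
  .X 0 * .X 1 - .X 2 * .X 3

/-- `ℂ[z₁, z₂, z₃, z₄] / (z₁ z₂ - z₃ z₄)`. -/
abbrev CoordRing : Type := MvPolynomial (Fin 4) ℂ ⧸ Ideal.span {equation}

/-- The function `zᵢ` on the conifold. -/
def z (i : Fin 4) : CoordRing := Ideal.Quotient.mk _ (MvPolynomial.X i)

/-- The conifold `Y`. -/
abbrev Y : Scheme.{0} := Spec (.of CoordRing)

/-- `Y` as a scheme over `ℂ`. -/
abbrev strY : Y ⟶ Spec (.of ℂ) := Spec.map (CommRingCat.ofHom (algebraMap ℂ CoordRing))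

/-- The blow-up `Ỹ` of `Y` at the origin. -/
abbrev Yt : Scheme.{0} := BlowUp.blowUp (Ideal.span {z 0, z 1, z 2, z 3})

/-- The small resolution `Y₊`, the blow-up of `Y` along `(z₁, z₃)`. -/
abbrev Yp : Scheme.{0} := BlowUp.blowUp (Ideal.span {z 0, z 2})

/-- The small resolution `Y₋`, the blow-up of `Y` along `(z₁, z₄)`. -/
abbrev Ym : Scheme.{0} := BlowUp.blowUp (Ideal.span {z 0, z 3})

/-- `π : Ỹ ⟶ Y`. -/
abbrev πt : Yt ⟶ Y := BlowUp.blowUpπ (Ideal.span {z 0, z 1, z 2, z 3})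

/-- `π₊ : Y₊ ⟶ Y`. -/
abbrev πp : Yp ⟶ Y := BlowUp.blowUpπ (Ideal.span {z 0, z 2})

/-- `π₋ : Y₋ ⟶ Y`. -/
abbrev πm : Ym ⟶ Y := BlowUp.blowUpπ (Ideal.span {z 0, z 3})

/-! ### The representation scheme and its `GL₂`-action -/

/-- The polynomial ring in the entries of four `2 × 2` matrices. -/
abbrev EntryRing : Type := MvPolynomial (Fin 4 × Fin 2 × Fin 2) ℂ

/-- Four generic `2 × 2` matrices. -/
def entryMatrix (i : Fin 4) : Matrix (Fin 2) (Fin 2) EntryRing :=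
  Matrix.of fun a b => MvPolynomial.X (i, a, b)

/-- The ideal of the conditions that four `2 × 2` matrices `M₁, M₂, M₃, M₄` are the images of
`z₁, z₂, z₃, z₄` under a representation of `ℂ[z₁, z₂, z₃, z₄] / (z₁ z₂ - z₃ z₄)`: they commute and
`M₁ M₂ - M₃ M₄ = 0`. -/
def repIdeal : Ideal EntryRing :=
  Ideal.span
    ({f | ∃ i j a b, f = (entryMatrix i * entryMatrix j - entryMatrix j * entryMatrix i) a b} ∪
     {f | ∃ a b, f = (entryMatrix 0 * entryMatrix 1 - entryMatrix 2 * entryMatrix 3) a b})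

/-- The coordinate ring of the representation scheme. -/
def RepRing : Type := EntryRing ⧸ repIdeal

instance : CommRing RepRing := inferInstanceAs (CommRing (EntryRing ⧸ repIdeal))

instance : Algebra ℂ RepRing := inferInstanceAs (Algebra ℂ (EntryRing ⧸ repIdeal))

/-- The quotient map from the polynomial ring in the matrix entries. -/
def repMk : EntryRing →ₐ[ℂ] RepRing := Ideal.Quotient.mkₐ ℂ repIdeal

/-- The representation scheme `Rep(ℂ[z₁, z₂, z₃, z₄] / (z₁ z₂ - z₃ z₄), M₂(ℂ))`. -/
abbrev Rep : Scheme.{0} := Spec (.of RepRing)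

/-- `Rep` as a scheme over `ℂ`. -/
abbrev strRep : Rep ⟶ Spec (.of ℂ) := Spec.map (CommRingCat.ofHom (algebraMap ℂ RepRing))

/-- The universal representation: the matrix `ρ(zᵢ)` over the coordinate ring of `Rep`. -/
def univ (i : Fin 4) : Matrix (Fin 2) (Fin 2) RepRing :=
  (entryMatrix i).map repMk

theorem univ_commute (i j : Fin 4) : univ i * univ j = univ j * univ i := by
  ext a b
  have h : repMk
      ((entryMatrix i * entryMatrix j - entryMatrix j * entryMatrix i) a b) = 0 :=
    Ideal.Quotient.eq_zero_iff_mem.2 (Ideal.subset_span (Or.inl ⟨i, j, a, b, rfl⟩))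
  rw [Matrix.sub_apply, map_sub, sub_eq_zero] at h
  simpa only [univ, ← Matrix.map_mul, Matrix.map_apply] using h

theorem univ_equation : univ 0 * univ 1 = univ 2 * univ 3 := by
  ext a b
  have h : repMk
      ((entryMatrix 0 * entryMatrix 1 - entryMatrix 2 * entryMatrix 3) a b) = 0 :=
    Ideal.Quotient.eq_zero_iff_mem.2 (Ideal.subset_span (Or.inr ⟨a, b, rfl⟩))
  rw [Matrix.sub_apply, map_sub, sub_eq_zero] at h
  simpa only [univ, ← Matrix.map_mul, Matrix.map_apply] using h

/-- An `A`-valued point of `Rep`, given by matrices satisfying the defining conditions. -/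
def repLift {A : Type} [CommRing A] [Algebra ℂ A] (M : Fin 4 → Matrix (Fin 2) (Fin 2) A)
    (hc : ∀ i j, M i * M j = M j * M i) (he : M 0 * M 1 = M 2 * M 3) : RepRing →ₐ[ℂ] A :=
  Ideal.Quotient.liftₐ repIdeal (MvPolynomial.aeval fun p => M p.1 p.2.1 p.2.2) (by
    have hM : ∀ i, (entryMatrix i).map (MvPolynomial.aeval (R := ℂ)
        fun p : Fin 4 × Fin 2 × Fin 2 => M p.1 p.2.1 p.2.2) = M i := fun i => by
      ext a b; simp [entryMatrix]
    have hN : ∀ i j a b, MvPolynomial.aeval (R := ℂ)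
        (fun p : Fin 4 × Fin 2 × Fin 2 => M p.1 p.2.1 p.2.2)
        ((entryMatrix i * entryMatrix j) a b) = (M i * M j) a b := fun i j a b => by
      rw [← Matrix.map_apply (f := MvPolynomial.aeval (R := ℂ)
        (fun p : Fin 4 × Fin 2 × Fin 2 => M p.1 p.2.1 p.2.2)), Matrix.map_mul, hM, hM]
    suffices h : repIdeal ≤ RingHom.ker (MvPolynomial.aeval (R := ℂ)
        (fun p : Fin 4 × Fin 2 × Fin 2 => M p.1 p.2.1 p.2.2)) from fun f hf => h hf
    rw [repIdeal, Ideal.span_le]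
    rintro f (⟨i, j, a, b, rfl⟩ | ⟨a, b, rfl⟩)
    · rw [SetLike.mem_coe, RingHom.mem_ker, Matrix.sub_apply, map_sub, hN, hN, hc, sub_self]
    · rw [SetLike.mem_coe, RingHom.mem_ker, Matrix.sub_apply, map_sub, hN, hN, he, sub_self])

theorem univ_map_repLift {A : Type} [CommRing A] [Algebra ℂ A]
    (M : Fin 4 → Matrix (Fin 2) (Fin 2) A)
    (hc : ∀ i j, M i * M j = M j * M i) (he : M 0 * M 1 = M 2 * M 3) (i : Fin 4) :
    (univ i).map (repLift M hc he) = M i := by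
  ext a b
  change MvPolynomial.aeval _ (MvPolynomial.X (i, a, b)) = _
  simp

/-- The coordinate ring of `GL₂`: the polynomial ring in the entries of a `2 × 2` matrix, with the
determinant inverted. -/
def GLRing : Type :=
  Localization.Away (Matrix.mvPolynomialX (Fin 2) (Fin 2) ℂ).det

instance : CommRing GLRing :=
  inferInstanceAs (CommRing (Localization.Away (Matrix.mvPolynomialX (Fin 2) (Fin 2) ℂ).det))

instance : Algebra (MvPolynomial (Fin 2 × Fin 2) ℂ) GLRing :=
  inferInstanceAs (Algebra (MvPolynomial (Fin 2 × Fin 2) ℂ)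
    (Localization.Away (Matrix.mvPolynomialX (Fin 2) (Fin 2) ℂ).det))

instance : Algebra ℂ GLRing :=
  inferInstanceAs (Algebra ℂ (Localization.Away (Matrix.mvPolynomialX (Fin 2) (Fin 2) ℂ).det))

instance : IsScalarTower ℂ (MvPolynomial (Fin 2 × Fin 2) ℂ) GLRing :=
  inferInstanceAs (IsScalarTower ℂ (MvPolynomial (Fin 2 × Fin 2) ℂ)
    (Localization.Away (Matrix.mvPolynomialX (Fin 2) (Fin 2) ℂ).det))

instance : IsLocalization.Away (Matrix.mvPolynomialX (Fin 2) (Fin 2) ℂ).det GLRing :=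
  inferInstanceAs (IsLocalization.Away (Matrix.mvPolynomialX (Fin 2) (Fin 2) ℂ).det
    (Localization.Away (Matrix.mvPolynomialX (Fin 2) (Fin 2) ℂ).det))

/-- The group scheme `GL₂` over `ℂ`. -/
abbrev GL₂ : Scheme.{0} := Spec (.of GLRing)

/-- `GL₂` as a scheme over `ℂ`. -/
abbrev strGL : GL₂ ⟶ Spec (.of ℂ) := Spec.map (CommRingCat.ofHom (algebraMap ℂ GLRing))

/-- The universal invertible matrix. -/
def univGL : Matrix (Fin 2) (Fin 2) GLRing :=
  (Matrix.mvPolynomialX (Fin 2) (Fin 2) ℂ).map (algebraMap _ GLRing)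

theorem isUnit_det_univGL : IsUnit univGL.det := by
  have h := IsLocalization.Away.algebraMap_isUnit (S := GLRing)
    (Matrix.mvPolynomialX (Fin 2) (Fin 2) ℂ).det
  rwa [RingHom.map_det] at h

/-- The universal matrix `g`, over the coordinate ring of `GL₂ × Rep`. -/
def actG : Matrix (Fin 2) (Fin 2) (GLRing ⊗[ℂ] RepRing) :=
  univGL.map (Algebra.TensorProduct.includeLeft : GLRing →ₐ[ℂ] GLRing ⊗[ℂ] RepRing)

theorem isUnit_det_actG : IsUnit actG.det := by
  have h := isUnit_det_univGL.map
    (Algebra.TensorProduct.includeLeft : GLRing →ₐ[ℂ] GLRing ⊗[ℂ] RepRing)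
  rw [AlgHom.map_det] at h
  exact h

/-- The universal `ρ(zᵢ)`, over the coordinate ring of `GL₂ × Rep`. -/
def actX (i : Fin 4) : Matrix (Fin 2) (Fin 2) (GLRing ⊗[ℂ] RepRing) :=
  (univ i).map (Algebra.TensorProduct.includeRight : RepRing →ₐ[ℂ] GLRing ⊗[ℂ] RepRing)

theorem conj_mul_conj (A B : Matrix (Fin 2) (Fin 2) (GLRing ⊗[ℂ] RepRing)) :
    (actG * A * actG⁻¹) * (actG * B * actG⁻¹) = actG * (A * B) * actG⁻¹ := by
  simp only [Matrix.mul_assoc, Matrix.nonsing_inv_mul_cancel_left _ _ isUnit_det_actG]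

/-- The coaction: `ρ(zᵢ) ↦ g ρ(zᵢ) g⁻¹`. -/
def coaction : RepRing →ₐ[ℂ] GLRing ⊗[ℂ] RepRing :=
  repLift (fun i => actG * actX i * actG⁻¹)
    (fun i j => by
      simp only [conj_mul_conj, actX, ← Matrix.map_mul, univ_commute i j])
    (by simp only [conj_mul_conj, actX, ← Matrix.map_mul, univ_equation])

/-- The action `GL₂ × Rep ⟶ Rep`, `(g, ρ) ↦ g ρ g⁻¹`. -/
def action : pullback strGL strRep ⟶ Rep :=
  (pullbackSpecIso ℂ GLRing RepRing).hom ≫ Spec.map (CommRingCat.ofHom coaction.toRingHom)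

/-- The map `GL₂ × X ⟶ GL₂ × Rep` induced by `j : X ⟶ Rep`. -/
def prodMap {X : Scheme.{0}} (j : X ⟶ Rep) : pullback strGL (j ≫ strRep) ⟶ pullback strGL strRep :=
  pullback.map _ _ _ _ (𝟙 _) j (𝟙 _) (by simp) (by simp)

/-! ### The scheme `W` of D0-branes supported at one point -/

/-- The ideal of the condition that each `ρ(zᵢ)` has the form `[a, ε; 0, a]`. -/
def utIdeal : Ideal RepRing :=
  Ideal.span ({f | ∃ i, f = univ i 1 0} ∪ {f | ∃ i, f = univ i 0 0 - univ i 1 1})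

/-- The coordinate ring of `W_ut`. -/
def WutRing : Type := RepRing ⧸ utIdeal

instance : CommRing WutRing := inferInstanceAs (CommRing (RepRing ⧸ utIdeal))

instance : Algebra ℂ WutRing := inferInstanceAs (Algebra ℂ (RepRing ⧸ utIdeal))

/-- The quotient map `𝒪(Rep) → 𝒪(W_ut)`. -/
def utMk : RepRing →ₐ[ℂ] WutRing := Ideal.Quotient.mkₐ ℂ utIdeal

/-- The closed subscheme `W_ut` of `Rep`, of all `ρ` with each `ρ(zᵢ)` of the form
`[aᵢ, εᵢ; 0, aᵢ]`. -/
abbrev Wut : Scheme.{0} := Spec (.of WutRing)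

/-- The inclusion of `W_ut` in `Rep`. -/
abbrev Wutι : Wut ⟶ Rep := Spec.map (CommRingCat.ofHom utMk.toRingHom)

/-- The map `GL₂ × W_ut ⟶ Rep`, `(g, ρ) ↦ g ρ g⁻¹`. -/
def sweep : pullback strGL (Wutι ≫ strRep) ⟶ Rep := prodMap Wutι ≫ action

/-- The scheme `W`, the scheme-theoretic image of `GL₂ × W_ut` in `Rep`. -/
abbrev W : Scheme.{0} := sweep.image

/-- The inclusion of `W` in `Rep`. -/
abbrev Wι : W ⟶ Rep := sweep.imageι

/-- The functions `½ Tr ρ(zᵢ)` on `Rep`. -/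
def halfTrace (i : Fin 4) : RepRing := algebraMap ℂ RepRing (1 / 2) * (univ i).trace

/-- The map `ℂ[z₁, z₂, z₃, z₄] → 𝒪(Rep)`, `zᵢ ↦ ½ Tr ρ(zᵢ)`. -/
def halfTraceHom : MvPolynomial (Fin 4) ℂ →ₐ[ℂ] RepRing := MvPolynomial.aeval halfTrace

/-- The morphism `Rep ⟶ 𝔸⁴` with coordinates `½ Tr ρ(zᵢ)`. -/
def traceMap : Rep ⟶ Spec (.of (MvPolynomial (Fin 4) ℂ)) :=
  Spec.map (CommRingCat.ofHom halfTraceHom.toRingHom)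

theorem action_traceMap : action ≫ traceMap = pullback.snd strGL strRep ≫ traceMap := by
  have h : coaction.comp halfTraceHom =
      (Algebra.TensorProduct.includeRight : RepRing →ₐ[ℂ] GLRing ⊗[ℂ] RepRing).comp
        halfTraceHom := by
    ext i
    have h₁ : coaction (univ i).trace =
        (Algebra.TensorProduct.includeRight : RepRing →ₐ[ℂ] GLRing ⊗[ℂ] RepRing)
          (univ i).trace := by
      rw [AddMonoidHom.map_trace, AddMonoidHom.map_trace]
      change ((univ i).map coaction).trace = (actX i).trace
      rw [coaction, univ_map_repLift, Matrix.mul_assoc, Matrix.trace_mul_comm, Matrix.mul_assoc,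
        Matrix.nonsing_inv_mul _ isUnit_det_actG, Matrix.mul_one]
    simp only [halfTraceHom, AlgHom.comp_apply, MvPolynomial.aeval_X, halfTrace, map_mul,
      AlgHom.commutes, h₁]
  have h' := congrArg AlgHom.toRingHom h
  rw [action, traceMap, ← pullbackSpecIso_hom_snd, Category.assoc, Category.assoc, ← Spec.map_comp,
    ← Spec.map_comp, ← CommRingCat.ofHom_comp, ← CommRingCat.ofHom_comp]
  exact congrArg (fun f => (pullbackSpecIso ℂ GLRing RepRing).hom ≫ Spec.map (CommRingCat.ofHom f))
    h'

/-- On `W_ut`, the functions `½ Tr ρ(zᵢ)` are the functions `aᵢ`. -/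
theorem utMk_halfTrace (i : Fin 4) : utMk (halfTrace i) = utMk (univ i 0 0) := by
  have h : utMk (univ i 0 0) = utMk (univ i 1 1) :=
    Ideal.Quotient.eq.2 (Ideal.subset_span (Or.inr ⟨i, rfl⟩))
  have h₂ : algebraMap ℂ WutRing (1 / 2) * 2 = 1 := by
    rw [← map_ofNat (algebraMap ℂ WutRing), ← map_mul]; norm_num
  rw [halfTrace, Matrix.trace_fin_two, map_mul, map_add, ← h, ← two_mul, ← mul_assoc,
    AlgHom.commutes, h₂, one_mul]

theorem utMk_equation : utMk (halfTraceHom equation) = 0 := by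
  have h₁ : ∀ i, utMk (univ i 1 0) = 0 := fun i =>
    Ideal.Quotient.eq_zero_iff_mem.2 (Ideal.subset_span (Or.inl ⟨i, rfl⟩))
  have h₂ := congrArg utMk (congrFun (congrFun univ_equation 0) 0)
  simp only [Matrix.mul_apply, Fin.sum_univ_two, map_add, map_mul, h₁, mul_zero, add_zero] at h₂
  simp only [equation, halfTraceHom, map_sub, map_mul, MvPolynomial.aeval_X, utMk_halfTrace, h₂,
    sub_self]

theorem sweep_traceMap : sweep ≫ traceMap =
    pullback.snd strGL (Wutι ≫ strRep) ≫
      Spec.map (CommRingCat.ofHom (utMk.comp halfTraceHom).toRingHom) := by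
  rw [sweep, Category.assoc, action_traceMap, prodMap, pullback.map, pullback.lift_snd_assoc,
    Category.assoc]
  exact congrArg (pullback.snd strGL (Wutι ≫ strRep) ≫ ·) (Spec.map_comp _ _).symm

theorem equation_le_ker : Ideal.span {equation} ≤
    RingHom.ker ((Scheme.ΓSpecIso (.of (MvPolynomial (Fin 4) ℂ))).inv ≫
      (Wι ≫ traceMap).appTop).hom := by
  rw [Ideal.span_singleton_le_iff_mem, RingHom.mem_ker]
  apply sweep.toImage_app_injective ⟨⊤, isAffineOpen_top _⟩
  refine Eq.trans ?_ (map_zero _).symm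
  change ((Scheme.ΓSpecIso (.of (MvPolynomial (Fin 4) ℂ))).inv ≫
    (Wι ≫ traceMap).appTop ≫ sweep.toImage.appTop) equation = 0
  rw [← Scheme.Hom.comp_appTop, Scheme.Hom.toImage_imageι_assoc, sweep_traceMap,
    Scheme.Hom.comp_appTop, ← Scheme.ΓSpecIso_inv_naturality_assoc]
  change ((pullback.snd strGL (Wutι ≫ strRep)).appTop) ((Scheme.ΓSpecIso _).inv
    (utMk (halfTraceHom equation))) = 0
  rw [utMk_equation, map_zero, map_zero]

/-- The morphism `π^W : W ⟶ Y`, with `π^W,♯(zᵢ) = ½ Tr ρ(zᵢ)`. -/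
def πW : W ⟶ Y :=
  (Wι ≫ traceMap).liftQuotient (Ideal.span {equation}) equation_le_ker

theorem πW_comp : πW ≫ Spec.map (CommRingCat.ofHom (Ideal.Quotient.mk (Ideal.span {equation}))) =
    Wι ≫ traceMap :=
  Scheme.Hom.liftQuotient_comp _ _ _

/-- A `GL₂`-invariant (locally closed) subscheme of `W`: the action of `GL₂` on `Rep` restricts to
an action on it. -/
structure InvariantSubscheme where
  carrier : Scheme.{0}
  /-- The inclusion in `W`. -/
  ι : carrier ⟶ W
  isImmersion : IsImmersion ι
  /-- The restricted action; it is unique, as `ι ≫ Wι` is a monomorphism. -/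
  act : pullback strGL ((ι ≫ Wι) ≫ strRep) ⟶ carrier
  act_comp : act ≫ ι ≫ Wι = prodMap (ι ≫ Wι) ≫ action

end Conifold

end

noncomputable section

/-! ### Charts of blow-ups -/

namespace BlowUp

variable {R : Type} [CommRing R] {I : Ideal R}

/-- The element `a * t` of degree one of the Rees algebra. -/
def degOne (a : I) : reesAlgebra I :=
  ⟨Polynomial.monomial 1 (a : R), reesAlgebra.monomial_mem.2 (by simp)⟩

theorem degOne_mem (a : I) : degOne a ∈ reesPiece I 1 := ⟨a, rfl⟩

/-- The affine blow-up algebra `R[I / a]`. -/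
def Chart (a : I) : Type := HomogeneousLocalization.Away (reesPiece I) (degOne a)

instance (a : I) : CommRing (Chart a) :=
  inferInstanceAs (CommRing (HomogeneousLocalization.Away (reesPiece I) (degOne a)))

/-- The inclusion of the affine blow-up algebra in the localization of the Rees algebra. -/
def chartVal (a : I) : Chart a →+* Localization (Submonoid.powers (degOne a)) where
  toFun := HomogeneousLocalization.val
  map_one' := HomogeneousLocalization.val_one
  map_mul' := HomogeneousLocalization.val_mul
  map_zero' := HomogeneousLocalization.val_zero
  map_add' := HomogeneousLocalization.val_add

theorem chartVal_injective (a : I) : Function.Injective (chartVal a) :=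
  HomogeneousLocalization.val_injective _

/-- The structure map of the affine blow-up algebra. -/
def chartMap (a : I) : R →+* Chart a :=
  (HomogeneousLocalization.fromZeroRingHom (reesPiece I) _).comp (algebraMap R (reesPiece I 0))

/-- The open immersion of a chart in the blow-up. -/
def chartι (a : I) : Spec (.of (Chart a)) ⟶ blowUp I :=
  Proj.awayι (reesPiece I) (degOne a) (degOne_mem a) one_pos

instance (a : I) : IsOpenImmersion (chartι a) :=
  inferInstanceAs (IsOpenImmersion (Proj.awayι _ _ _ _))

theorem chartι_π (a : I) : chartι a ≫ blowUpπ I = Spec.map (CommRingCat.ofHom (chartMap a)) := by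
  refine (Proj.awayι_toSpecZero_assoc (reesPiece I) (degOne a) (degOne_mem a) one_pos _).trans ?_
  exact (Spec.map_comp _ _).symm

instance : IsSeparated (blowUpπ I) := by
  have : IsSeparated (Proj.toSpecZero (reesPiece I)) := inferInstance
  exact MorphismProperty.comp_mem (W := @IsSeparated) _ _ this inferInstance

/-- The fraction `r / a ^ n` in the affine blow-up algebra, for `r ∈ I ^ n`. -/
def frac (a : I) (n : ℕ) (r : R) (hr : r ∈ I ^ n) : Chart a :=
  HomogeneousLocalization.Away.mk (reesPiece I) (degOne_mem a) n
    ⟨Polynomial.monomial n r, reesAlgebra.monomial_mem.2 hr⟩ ⟨r, by simp⟩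

theorem exists_frac {a : I} (x : Chart a) : ∃ n r hr, frac a n r hr = x := by
  obtain ⟨n, ⟨y, hy'⟩, ⟨r, hr⟩, hx⟩ :=
    HomogeneousLocalization.Away.mk_surjective (reesPiece I) (degOne_mem a) x
  rw [smul_eq_mul, mul_one] at hr
  subst hr
  exact ⟨n, r, reesAlgebra.monomial_mem.1 hy', hx⟩

theorem degOne_pow (a : I) (n : ℕ) :
    ((degOne a ^ n : reesAlgebra I) : R[X]) = Polynomial.monomial n ((a : R) ^ n) := by
  rw [SubmonoidClass.coe_pow, degOne, Polynomial.monomial_pow, one_mul]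

theorem chartVal_chartMap (a : I) (r : R) : chartVal a (chartMap a r) =
    algebraMap (reesAlgebra I) (Localization (Submonoid.powers (degOne a)))
      (algebraMap R (reesAlgebra I) r) := by
  rw [← Localization.mk_one_eq_algebraMap]
  rfl

theorem chartVal_frac (a : I) (n : ℕ) (r : R) (hr : r ∈ I ^ n) : chartVal a (frac a n r hr) =
    Localization.mk ⟨Polynomial.monomial n r, reesAlgebra.monomial_mem.2 hr⟩
      (⟨degOne a ^ n, n, rfl⟩ : Submonoid.powers (degOne a)) := rfl

theorem frac_mul (a : I) (n : ℕ) (r : R) (hr : r ∈ I ^ n) :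
    frac a n r hr * chartMap a a ^ n = chartMap a r := by
  apply chartVal_injective
  rw [map_mul, map_pow, chartVal_chartMap, chartVal_chartMap, chartVal_frac,
    ← Localization.mk_one_eq_algebraMap, ← Localization.mk_one_eq_algebraMap, Localization.mk_pow,
    Localization.mk_mul, Localization.mk_eq_mk_iff, Localization.r_iff_exists]
  refine ⟨1, ?_⟩
  apply Subtype.ext
  simp only [Submonoid.coe_one, one_mul, one_pow, mul_one, MulMemClass.coe_mul,
    SubmonoidClass.coe_pow]
  rw [← SubmonoidClass.coe_pow (degOne a), degOne_pow]
  change Polynomial.monomial n r * Polynomial.C _ ^ n = _ * Polynomial.C r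
  rw [← map_pow, Polynomial.monomial_mul_C, Polynomial.monomial_mul_C, mul_comm]

theorem frac_one_mul {a : I} {r : R} (hr : r ∈ I ^ 1) :
    frac a 1 r hr * chartMap a a = chartMap a r := by
  simpa using frac_mul a 1 r hr

theorem chart_hom_ext {S : Type*} [CommRing S] {a : I} {f g : Chart a →+* S}
    (h : f.comp (chartMap a) = g.comp (chartMap a)) (ha : IsRegular (f (chartMap a a))) :
    f = g := by
  ext x
  obtain ⟨n, r, hr, rfl⟩ := exists_frac x
  have h' (s : R) : f (chartMap a s) = g (chartMap a s) := congrArg (· s) h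
  apply (ha.pow n).right
  have h₁ := congrArg f (frac_mul a n r hr)
  have h₂ := congrArg g (frac_mul a n r hr)
  rw [map_mul, map_pow] at h₁ h₂
  rw [← h', ← h'] at h₂
  exact h₁.trans h₂.symm

/-- A ring map inverting `a` extends to the affine blow-up algebra. -/
def chartToUnit {S : Type*} [CommRing S] (a : I) (f : R →+* S) (u : Sˣ) (hu : f a = u) :
    Chart a →+* S :=
  RingHom.comp
    (IsLocalization.Away.lift (S := Localization (Submonoid.powers (degOne a)))
      (g := (Polynomial.eval₂RingHom f (↑u⁻¹ : S)).comp (reesAlgebra I).val.toRingHom) (degOne a)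
      (by simp [degOne, hu]))
    (chartVal a)

theorem chartToUnit_chartMap {S : Type*} [CommRing S] (a : I) (f : R →+* S) (u : Sˣ)
    (hu : f a = u) (r : R) : chartToUnit a f u hu (chartMap a r) = f r := by
  rw [chartToUnit, RingHom.comp_apply, chartVal_chartMap, IsLocalization.Away.lift_eq]
  simp

theorem chartToUnit_injective {S : Type*} [CommRing S] (a : I) (f : R →+* S) (u : Sˣ)
    (hu : f a = u) (hf : Function.Injective f) : Function.Injective (chartToUnit a f u hu) := by
  rw [injective_iff_map_eq_zero]
  intro x hx
  obtain ⟨n, r, hr, rfl⟩ := exists_frac x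
  have h := congrArg (chartToUnit a f u hu) (frac_mul a n r hr)
  rw [map_mul, hx, zero_mul, chartToUnit_chartMap, eq_comm, map_eq_zero_iff f hf] at h
  subst h
  refine HomogeneousLocalization.mk_eq_zero_of_num _ ?_
  apply Subtype.ext
  apply Subtype.ext
  exact map_zero _

theorem chart_isDomain [IsDomain R] {a : I} (ha : (a : R) ≠ 0) : IsDomain (Chart a) :=
  Function.Injective.isDomain _
    (chartToUnit_injective a (algebraMap R (FractionRing R)) (Units.mk0 _ (by simpa using ha)) rfl
      (IsFractionRing.injective R (FractionRing R)))

theorem chartMap_injective [IsDomain R] {a : I} (ha : (a : R) ≠ 0) :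
    Function.Injective (chartMap a) := by
  let u : (FractionRing R)ˣ := Units.mk0 (algebraMap R (FractionRing R) a) (by simpa using ha)
  have hu : algebraMap R (FractionRing R) a = u := rfl
  refine .of_comp (f := chartToUnit a (algebraMap R (FractionRing R)) u hu) fun x y h => ?_
  simp only [Function.comp_apply, chartToUnit_chartMap] at h
  exact IsFractionRing.injective R (FractionRing R) h

/-- The universal property of the affine blow-up algebra, for domains: a ring map for which the
image of `I` consists of multiples of the image of `a ∈ I` factors through `R[I / a]`. -/
theorem exists_chart_lift {S : Type*} [CommRing S] [IsDomain S] (a : I) (f : R →+* S)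
    (ha : f a ≠ 0) (h : ∀ x ∈ I, f a ∣ f x) :
    ∃ g : Chart a →+* S, g.comp (chartMap a) = f := by
  let K := FractionRing S
  have hinj : Function.Injective (algebraMap S K) := IsFractionRing.injective S K
  let u : Kˣ := Units.mk0 (algebraMap S K (f a)) (by simpa using ha)
  have hu : (algebraMap S K).comp f a = u := rfl
  let g := chartToUnit a ((algebraMap S K).comp f) u hu
  have hpow (n : ℕ) (r : R) (hr : r ∈ I ^ n) : f a ^ n ∣ f r := by
    have h₁ : I.map f ≤ Ideal.span {f a} := by
      rw [Ideal.map_le_iff_le_comap]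
      exact fun x hx => Ideal.mem_span_singleton.2 (h x hx)
    have h₂ := Ideal.pow_right_mono h₁ n
    rw [← Ideal.map_pow, Ideal.span_singleton_pow] at h₂
    exact Ideal.mem_span_singleton.1 (h₂ (Ideal.mem_map_of_mem f hr))
  have hg (x : Chart a) : g x ∈ (algebraMap S K).range := by
    obtain ⟨n, r, hr, rfl⟩ := exists_frac x
    obtain ⟨s, hs⟩ := hpow n r hr
    refine ⟨s, ?_⟩
    have h := congrArg g (frac_mul a n r hr)
    rw [map_mul, map_pow] at h
    simp only [g, chartToUnit_chartMap] at h
    rw [RingHom.comp_apply, RingHom.comp_apply, hs, map_mul, map_pow, mul_comm] at h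
    exact (mul_left_cancel₀ (pow_ne_zero n u.ne_zero) h).symm
  let e : S ≃+* (algebraMap S K).range := RingEquiv.ofBijective (algebraMap S K).rangeRestrict
    ⟨fun x y h => hinj (congrArg Subtype.val h), (algebraMap S K).rangeRestrict_surjective⟩
  refine ⟨e.symm.toRingHom.comp (g.codRestrict _ hg), ?_⟩
  ext r
  apply e.injective
  simp only [RingHom.comp_apply, RingEquiv.toRingHom_eq_coe, RingEquiv.coe_toRingHom,
    RingEquiv.apply_symm_apply]
  apply Subtype.ext
  exact chartToUnit_chartMap a _ u hu r

theorem irrelevant_le_span {ι : Type*} {e : ι → I}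
    (he : Ideal.span (Set.range fun i => (e i : R)) = I) :
    (HomogeneousIdeal.irrelevant (reesPiece I)).toIdeal ≤
      Ideal.span (Set.range fun i => degOne (e i)) := by
  classical
  have key (n : ℕ) (r : R) (hr : r ∈ I ^ (n + 1)) :
      (⟨Polynomial.monomial (n + 1) r, reesAlgebra.monomial_mem.2 hr⟩ : reesAlgebra I) ∈
        Ideal.span (Set.range fun i => degOne (e i)) := by
    have main (y : R) (hy : y ∈ I ^ n) (x : R) (hx : x ∈ I) :
        ∃ h, (⟨Polynomial.monomial (n + 1) (x * y), h⟩ : reesAlgebra I) ∈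
          Ideal.span (Set.range fun i => degOne (e i)) := by
      rw [← he] at hx
      induction hx using Submodule.span_induction with
      | mem x hx =>
        obtain ⟨i, rfl⟩ := hx
        refine ⟨reesAlgebra.monomial_mem.2 (by
          rw [pow_succ']; exact Ideal.mul_mem_mul (e i).2 hy), ?_⟩
        have h := Ideal.mul_mem_right (⟨Polynomial.monomial n y, reesAlgebra.monomial_mem.2 hy⟩ :
          reesAlgebra I) (Ideal.span (Set.range fun i => degOne (e i)))
          (Ideal.subset_span ⟨i, rfl⟩)
        convert h using 1
        apply Subtype.ext
        refine Eq.trans ?_ (Polynomial.monomial_mul_monomial 1 n _ y).symm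
        dsimp only
        congr 2
        exact add_comm n 1
      | zero =>
        refine ⟨reesAlgebra.monomial_mem.2 (by simp), ?_⟩
        refine (congrArg (· ∈ Ideal.span _) (Subtype.ext ?_)).mpr (Ideal.zero_mem _)
        simp
      | add x x' _ _ h h' =>
        obtain ⟨h₁, h₂⟩ := h
        obtain ⟨h₁', h₂'⟩ := h'
        rw [reesAlgebra.monomial_mem] at h₁ h₁'
        refine ⟨reesAlgebra.monomial_mem.2 (by rw [add_mul]; exact add_mem h₁ h₁'), ?_⟩
        convert add_mem h₂ h₂' using 1
        apply Subtype.ext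
        simp [add_mul]
      | smul c x _ h =>
        obtain ⟨h₁, h₂⟩ := h
        rw [reesAlgebra.monomial_mem] at h₁
        refine ⟨reesAlgebra.monomial_mem.2 (by
          rw [smul_eq_mul, mul_assoc]; exact Ideal.mul_mem_left _ _ h₁), ?_⟩
        convert Ideal.mul_mem_left _ (algebraMap R (reesAlgebra I) c) h₂ using 1
        apply Subtype.ext
        change _ = Polynomial.C c * _
        simp [mul_assoc]
    suffices h : ∃ h, (⟨Polynomial.monomial (n + 1) r, h⟩ : reesAlgebra I) ∈
        Ideal.span (Set.range fun i => degOne (e i)) from h.2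
    rw [pow_succ'] at hr
    refine Submodule.mul_induction_on hr (fun x hx y hy => main y hy x hx) fun x y hx hy => ?_
    obtain ⟨h₁, h₂⟩ := hx
    obtain ⟨h₁', h₂'⟩ := hy
    rw [reesAlgebra.monomial_mem] at h₁ h₁'
    refine ⟨reesAlgebra.monomial_mem.2 (add_mem h₁ h₁'), ?_⟩
    convert add_mem h₂ h₂' using 1
    apply Subtype.ext
    simp
  intro x hx
  rw [← DirectSum.sum_support_decompose (reesPiece I) x]
  refine Ideal.sum_mem _ fun n _ => ?_
  match n with
  | 0 =>
    have h : (DirectSum.decompose (reesPiece I) x 0 : reesAlgebra I) = 0 := by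
      simpa [HomogeneousIdeal.mem_irrelevant_iff, GradedRing.proj_apply] using hx
    rw [h]
    exact Ideal.zero_mem _
  | n + 1 =>
    obtain ⟨⟨y, hy⟩, r, hr⟩ := DirectSum.decompose (reesPiece I) x (n + 1)
    change Polynomial.monomial (n + 1) r = y at hr
    subst hr
    exact key n r (reesAlgebra.monomial_mem.1 hy)

theorem opensRange_chartι (a : I) :
    (chartι a).opensRange = Proj.basicOpen (reesPiece I) (degOne a) :=
  Proj.opensRange_awayι (reesPiece I) (degOne a) (degOne_mem a) one_pos

theorem exists_mem_range_chartι {ι : Type*} {e : ι → I}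
    (he : Ideal.span (Set.range fun i => (e i : R)) = I) (x : blowUp I) :
    ∃ i, x ∈ (chartι (e i)).opensRange := by
  have h := Proj.iSup_basicOpen_eq_top (reesPiece I) _ (irrelevant_le_span he)
  have hx : x ∈ ⨆ i, Proj.basicOpen (reesPiece I) (degOne (e i)) := h ▸ trivial
  obtain ⟨i, hi⟩ := TopologicalSpace.Opens.mem_iSup.1 hx
  exact ⟨i, by rwa [opensRange_chartι]⟩

theorem chartι_preimage_opensRange (a b : I) :
    chartι a ⁻¹ᵁ (chartι b).opensRange = PrimeSpectrum.basicOpen (frac a 1 b (by simp)) := by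
  rw [opensRange_chartι]
  refine (Proj.awayι_preimage_basicOpen (reesPiece I) (degOne_mem a) one_pos (degOne_mem b)
    one_pos).trans ?_
  congr 1
  apply chartVal_injective
  rw [chartVal_frac]
  refine (HomogeneousLocalization.Away.val_mk (𝒜 := reesPiece I) 1 (degOne_mem a) _ _).trans ?_
  congr 1
  exact pow_one _

/-- Over the locus where `a ∈ I` is invertible, the blow-up is contained in the chart of `a`. -/
theorem mem_range_chartι (a : I) (x : blowUp I)
    (hx : blowUpπ I x ∈ PrimeSpectrum.basicOpen (a : R)) : x ∈ (chartι a).opensRange := by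
  obtain ⟨b, y, rfl⟩ := exists_mem_range_chartι (e := id) (by simp) x
  change y ∈ chartι b ⁻¹ᵁ (chartι a).opensRange
  rw [chartι_preimage_opensRange]
  rw [← Scheme.Hom.comp_apply] at hx
  simp only [id] at hx
  rw [chartι_π] at hx
  change chartMap b a ∉ y.asIdeal at hx
  rw [← frac_one_mul (by simp)] at hx
  exact fun h => hx (Ideal.mul_mem_right _ _ h)

/-- Two points of a blow-up with values in a field agree if they have the same image, where an
element of `I` does not vanish. -/
theorem point_ext {K : Type} [Field K] (a : I) {x y : Spec (.of K) ⟶ blowUp I}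
    (h : x ≫ blowUpπ I = y ≫ blowUpπ I)
    (ha : ∀ p, (x ≫ blowUpπ I) p ∈ PrimeSpectrum.basicOpen (a : R)) : x = y := by
  have hx : Set.range x ⊆ Set.range (chartι a) := by
    rintro _ ⟨p, rfl⟩
    exact mem_range_chartι a _ (by simpa using ha p)
  have hy : Set.range y ⊆ Set.range (chartι a) := by
    rintro _ ⟨p, rfl⟩
    exact mem_range_chartι a _ (by simpa [h] using ha p)
  obtain ⟨f, hf⟩ := Spec.map_surjective (IsOpenImmersion.lift (chartι a) x hx)
  obtain ⟨g, hg⟩ := Spec.map_surjective (IsOpenImmersion.lift (chartι a) y hy)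
  have hf' := congrArg (· ≫ chartι a) hf
  have hg' := congrArg (· ≫ chartι a) hg
  simp only [IsOpenImmersion.lift_fac] at hf' hg'
  rw [← hf', ← hg', Category.assoc, Category.assoc, chartι_π, ← Spec.map_comp, ← Spec.map_comp,
    Spec.map_inj] at h
  have ha' : f.hom (chartMap a a) ≠ 0 := by
    have hp := ha (⊥ : PrimeSpectrum K)
    rw [← hf', Category.assoc, chartι_π, ← Spec.map_comp] at hp
    exact fun h => hp (by change f.hom (chartMap a a) ∈ (⊥ : Ideal K); exact h)
  have := chart_hom_ext (f := f.hom) (g := g.hom) (congrArg CommRingCat.Hom.hom h)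
    (IsRegular.of_ne_zero ha')
  rw [← hf', ← hg', CommRingCat.hom_ext this]

/-- Two lifts to a blow-up, of an open part of a morphism from an integral scheme which does not
factor through the center, agree. -/
theorem lift_unique {T P : Scheme.{0}} [IsIntegral T] (f : T ⟶ Spec (.of R)) (a : I)
    (ha : (f ⁻¹ᵁ PrimeSpectrum.basicOpen (a : R) : Set T).Nonempty) (o : P ⟶ T)
    [IsOpenImmersion o] {x y : P ⟶ blowUp I} (hx : x ≫ blowUpπ I = o ≫ f)
    (hy : y ≫ blowUpπ I = o ≫ f) : x = y := by
  have : IsReduced P := isReduced_of_isOpenImmersion o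
  refine ext_of_fromSpecResidueField_eq x y (blowUpπ I)
    (o ⁻¹ᵁ f ⁻¹ᵁ PrimeSpectrum.basicOpen (a : R))
    (((f ⁻¹ᵁ PrimeSpectrum.basicOpen (a : R)).2.dense ha).preimage o.isOpenEmbedding.isOpenMap)
    (fun p hp => ?_) (hx.trans hy.symm)
  refine point_ext (K := P.residueField p) a (by simp only [Category.assoc, hx, hy]) fun q => ?_
  have hq : P.fromSpecResidueField p q = p := Scheme.fromSpecResidueField_apply p q
  rw [Category.assoc, hx, Scheme.Hom.comp_apply, hq]
  exact hp

/-- A morphism from an integral scheme which does not factor through the center lifts to the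
blow-up if it does so locally. -/
theorem exists_lift {T : Scheme.{0}} [IsIntegral T] (f : T ⟶ Spec (.of R)) (a : I)
    (ha : (f ⁻¹ᵁ PrimeSpectrum.basicOpen (a : R) : Set T).Nonempty) (𝒰 : T.OpenCover)
    (g : ∀ i, 𝒰.X i ⟶ blowUp I) (hg : ∀ i, g i ≫ blowUpπ I = 𝒰.f i ≫ f) :
    ∃ h : T ⟶ blowUp I, h ≫ blowUpπ I = f ∧ ∀ i, 𝒰.f i ≫ h = g i := by
  refine ⟨𝒰.glueMorphisms g fun i j => ?_, ?_, fun i => 𝒰.ι_glueMorphisms _ _ i⟩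
  · refine lift_unique f a ha (pullback.fst (𝒰.f i) (𝒰.f j) ≫ 𝒰.f i) ?_ ?_
    · rw [Category.assoc, Category.assoc, hg]
    · rw [Category.assoc, pullback.condition, Category.assoc, hg]
  · refine 𝒰.hom_ext _ _ fun i => ?_
    rw [𝒰.ι_glueMorphisms_assoc, hg]

end BlowUp

/-! ### Geometric quotients with local sections -/

theorem Scheme.section_ext {X : Scheme.{0}} {U : X.Opens} {f g : Γ(X, U)}
    (h : ∀ p ∈ U, ∃ (O : Scheme.{0}) (o : O ⟶ X) (_ : IsOpenImmersion o),
      p ∈ o.opensRange ∧ o.app U f = o.app U g) : f = g := by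
  refine TopCat.Presheaf.section_ext X.sheaf U f g fun p hp => ?_
  obtain ⟨O, o, _, ⟨z, rfl⟩, h⟩ := h p hp
  apply (ConcreteCategory.bijective_of_isIso (o.stalkMap z)).1
  refine (o.germ_stalkMap_apply U z hp f).trans ?_
  rw [h]
  exact (o.germ_stalkMap_apply U z hp g).symm

theorem Scheme.appLE_congr_hom {X Y : Scheme.{0}} {f g : X ⟶ Y} (h : f = g) (U : Y.Opens)
    (V : X.Opens) (e : V ≤ f ⁻¹ᵁ U) : f.appLE U V e = g.appLE U V (h ▸ e) := by
  subst h; rfl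

theorem Scheme.exists_app_eq {X Q : Scheme.{0}} (φ : X ⟶ Q)
    (hφ : ∀ U : Q.Opens, Function.Injective (φ.app U)) (U : Q.Opens) (f : Γ(X, φ ⁻¹ᵁ U))
    {ι : Type*} {W : ι → Q.Opens} (hW : ∀ i, W i ≤ U) (hU : U ≤ ⨆ i, W i)
    (hf : ∀ i, ∃ t : Γ(Q, W i), φ.app (W i) t =
      X.presheaf.map (homOfLE (φ.preimage_mono (hW i))).op f) :
    ∃ t : Γ(Q, U), φ.app U t = f := by
  choose t ht using hf
  have hnat {A B : Q.Opens} (h : A ≤ B) (b : Γ(Q, B)) :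
      φ.app A (Q.presheaf.map (homOfLE h).op b) =
        X.presheaf.map (homOfLE (φ.preimage_mono h)).op (φ.app B b) := by
    rw [← CommRingCat.comp_apply, ← CommRingCat.comp_apply, Scheme.Hom.naturality]
    rfl
  obtain ⟨u, hu, -⟩ := TopCat.Sheaf.existsUnique_gluing' Q.sheaf W U (fun i => homOfLE (hW i)) hU t
    (fun i j => hφ _ (by
      refine (hnat inf_le_left (t i)).trans (Eq.trans ?_ (hnat inf_le_right (t j)).symm)
      rw [ht, ht, ← CommRingCat.comp_apply, ← CommRingCat.comp_apply, ← Functor.map_comp,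
        ← Functor.map_comp]
      rfl))
  refine ⟨u, TopCat.Sheaf.eq_of_locally_eq' X.sheaf (fun i => φ ⁻¹ᵁ W i) _
    (fun i => homOfLE (φ.preimage_mono (hW i))) ?_ _ _ fun i => ?_⟩
  · intro x hx
    obtain ⟨i, hi⟩ := TopologicalSpace.Opens.mem_iSup.1 (hU hx)
    exact TopologicalSpace.Opens.mem_iSup.2 ⟨i, hi⟩
  · exact (hnat (hW i) u).symm.trans ((congrArg (φ.app (W i)) (hu i)).trans (ht i))

theorem pullback_lift_eq_comp_lift {T O G X S : Scheme.{0}} {g : G ⟶ S} {x : X ⟶ S} (l : T ⟶ O)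
    {h : O ⟶ G} {f : O ⟶ X} (w : h ≫ g = f ≫ x) {a : T ⟶ G} {b : T ⟶ X} (w' : a ≫ g = b ≫ x)
    (ha : a = l ≫ h) (hb : b = l ≫ f) : pullback.lift a b w' = l ≫ pullback.lift h f w := by
  subst ha hb
  refine pullback.hom_ext ?_ ?_
  · exact (pullback.lift_fst _ _ _).trans
      ((congrArg (l ≫ ·) (pullback.lift_fst h f w)).symm.trans (Category.assoc _ _ _).symm)
  · exact (pullback.lift_snd _ _ _).trans
      ((congrArg (l ≫ ·) (pullback.lift_snd h f w)).symm.trans (Category.assoc _ _ _).symm)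

theorem IsGeometricQuotient.of_local_sections {S G X Q : Scheme.{0}} {g : G ⟶ S} {x : X ⟶ S}
    {y : Q ⟶ S} {σ : pullback g x ⟶ X} {φ : X ⟶ Q} (hφ : φ ≫ y = x)
    (hσ : σ ≫ φ = pullback.snd g x ≫ φ) {ι : Type*} {V : ι → Scheme.{0}} (v : ∀ i, V i ⟶ Q)
    [∀ i, IsOpenImmersion (v i)] (hv : ∀ q, ∃ i, q ∈ (v i).opensRange)
    (s : ∀ i, V i ⟶ X) (hs : ∀ i, s i ≫ φ = v i)
    (hloc : ∀ i (p : X), φ p ∈ (v i).opensRange →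
      ∃ (O : Scheme.{0}) (o : O ⟶ X) (_ : IsOpenImmersion o) (r : O ⟶ V i) (h : O ⟶ G)
        (w : h ≫ g = (r ≫ s i) ≫ x), p ∈ o.opensRange ∧ pullback.lift h (r ≫ s i) w ≫ σ = o)
    (htrans : ∀ (K : Type) [Field K] (a b : Spec (.of K) ⟶ G) (t : Spec (.of K) ⟶ X)
      (wa : a ≫ g = t ≫ x) (wb : b ≫ g = t ≫ x), ∃ (c : Spec (.of K) ⟶ G)
        (wc : c ≫ g = (pullback.lift a t wa ≫ σ) ≫ x),
        pullback.lift c (pullback.lift a t wa ≫ σ) wc ≫ σ = pullback.lift b t wb ≫ σ) :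
    IsGeometricQuotient g x y σ φ := by
  have hinj (U : Q.Opens) : Function.Injective (φ.app U) := by
    intro f₁ f₂ h
    refine Scheme.section_ext fun q _ => ?_
    obtain ⟨i, hi⟩ := hv q
    refine ⟨V i, v i, inferInstance, hi, ?_⟩
    rw [Scheme.Hom.app_eq_appLE, Scheme.appLE_congr_hom (hs i).symm, Scheme.Hom.comp_appLE,
      CommRingCat.comp_apply, CommRingCat.comp_apply, h]
  exact {
    comp_str := hφ
    invariant := hσ
    surjective := ⟨fun q => by
      obtain ⟨i, z, rfl⟩ := hv q
      exact ⟨s i z, by rw [← Scheme.Hom.comp_apply, hs]⟩⟩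
    orbits := ⟨fun p => by
      let T := pullback φ φ
      let t : Spec (.of (T.residueField p)) ⟶ T := T.fromSpecResidueField p
      let pt : Spec (.of (T.residueField p)) := (⊥ : PrimeSpectrum (T.residueField p))
      have ht : t pt = p := Scheme.fromSpecResidueField_apply p pt
      let z₁ := t ≫ pullback.fst φ φ
      let z₂ := t ≫ pullback.snd φ φ
      have hz : z₁ ≫ φ = z₂ ≫ φ := by simp only [z₁, z₂, Category.assoc, pullback.condition]
      obtain ⟨i, hi⟩ := hv ((z₁ ≫ φ) pt)
      have hi' := hi
      rw [hz] at hi'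
      obtain ⟨O₁, o₁, _, r₁, h₁, w₁, hp₁, e₁⟩ := hloc i (z₁ pt) hi
      obtain ⟨O₂, o₂, _, r₂, h₂, w₂, hp₂, e₂⟩ := hloc i (z₂ pt) hi'
      have hrange {O : Scheme.{0}} (o : O ⟶ X) [IsOpenImmersion o]
          (z : Spec (.of (T.residueField p)) ⟶ X) (h : z pt ∈ o.opensRange) :
          Set.range z ⊆ Set.range o := by
        rintro _ ⟨q, rfl⟩
        obtain rfl : q = pt := Subsingleton.elim (α := PrimeSpectrum (T.residueField p)) q pt
        exact h
      let l₁ := IsOpenImmersion.lift o₁ z₁ (hrange o₁ z₁ hp₁)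
      let l₂ := IsOpenImmersion.lift o₂ z₂ (hrange o₂ z₂ hp₂)
      have hl₁ : l₁ ≫ o₁ = z₁ := IsOpenImmersion.lift_fac ..
      have hl₂ : l₂ ≫ o₂ = z₂ := IsOpenImmersion.lift_fac ..
      have hr : l₁ ≫ r₁ = l₂ ≫ r₂ := by
        have e₁' := congrArg (l₁ ≫ · ≫ φ) e₁
        have e₂' := congrArg (l₂ ≫ · ≫ φ) e₂
        simp only [Category.assoc, hσ, pullback.lift_snd_assoc, hs] at e₁' e₂'
        rw [← cancel_mono (v i), Category.assoc, Category.assoc, e₁', e₂', reassoc_of% hl₁,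
          reassoc_of% hl₂, hz]
      obtain ⟨c, wc, hc⟩ := htrans (T.residueField p) (l₂ ≫ h₂) (l₁ ≫ h₁) (l₁ ≫ r₁ ≫ s i)
        (by rw [reassoc_of% hr, Category.assoc, w₂]; simp only [Category.assoc])
        (by rw [Category.assoc, w₁]; simp only [Category.assoc])
      have h₂' : pullback.lift (l₂ ≫ h₂) (l₁ ≫ r₁ ≫ s i) (by
          rw [reassoc_of% hr, Category.assoc, w₂]; simp only [Category.assoc]) ≫ σ = z₂ := by
        refine Eq.trans (b := (l₂ ≫ pullback.lift h₂ _ w₂) ≫ σ) ?_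
          ((Category.assoc _ _ _).trans ((congrArg (l₂ ≫ ·) e₂).trans hl₂))
        exact congrArg (· ≫ σ) (pullback_lift_eq_comp_lift l₂ w₂ _ rfl (by simp [reassoc_of% hr]))
      have h₁' : pullback.lift (l₁ ≫ h₁) (l₁ ≫ r₁ ≫ s i) (by
          rw [Category.assoc, w₁]; simp only [Category.assoc]) ≫ σ = z₁ := by
        refine Eq.trans (b := (l₁ ≫ pullback.lift h₁ _ w₁) ≫ σ) ?_
          ((Category.assoc _ _ _).trans ((congrArg (l₁ ≫ ·) e₁).trans hl₁))
        exact congrArg (· ≫ σ) (pullback_lift_eq_comp_lift l₁ w₁ _ rfl (by simp))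
      rw [h₁'] at hc
      refine ⟨pullback.lift c _ wc pt, ?_⟩
      rw [← Scheme.Hom.comp_apply]
      refine Eq.trans ?_ ht
      refine congrArg (fun k : _ ⟶ T => k pt) (pullback.hom_ext ?_ ?_)
      · exact (Category.assoc _ _ _).trans ((congrArg (_ ≫ ·) (pullback.lift_fst _ _ _)).trans hc)
      · exact (Category.assoc _ _ _).trans ((congrArg (_ ≫ ·) (pullback.lift_snd _ _ _)).trans
          ((pullback.lift_snd _ _ _).trans h₂'))⟩
    submersive U := by
      refine ⟨fun h => ?_, fun h => h.preimage φ.continuous⟩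
      have hU : U = ⋃ i, v i '' (s i ⁻¹' (φ ⁻¹' U)) := by
        ext q
        simp only [Set.mem_iUnion, Set.mem_image, Set.mem_preimage, ← Scheme.Hom.comp_apply, hs]
        constructor
        · intro hq
          obtain ⟨i, z, rfl⟩ := hv q
          exact ⟨i, z, hq, rfl⟩
        · rintro ⟨i, z, hz, rfl⟩
          exact hz
      rw [hU]
      exact isOpen_iUnion fun i => (v i).isOpenEmbedding.isOpenMap _ (h.preimage (s i).continuous)
    functions_injective := hinj
    functions U f := by
      constructor
      · rintro ⟨t, rfl⟩
        rw [Scheme.Hom.app_eq_appLE, Scheme.Hom.app_eq_appLE, ← CommRingCat.comp_apply,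
          ← CommRingCat.comp_apply, Scheme.Hom.appLE_comp_appLE, Scheme.Hom.appLE_comp_appLE,
          Scheme.appLE_congr_hom hσ]
      · intro hf
        have hle (i : ι) : v i ''ᵁ v i ⁻¹ᵁ U ≤ U := by
          rw [(v i).image_preimage_eq_opensRange_inf]; exact inf_le_right
        have hsv (i : ι) : v i ⁻¹ᵁ U ≤ s i ⁻¹ᵁ φ ⁻¹ᵁ U := by
          rw [← Scheme.Hom.comp_preimage, hs]
        refine Scheme.exists_app_eq φ hinj U f (W := fun i => v i ''ᵁ v i ⁻¹ᵁ U) hle ?_ fun i =>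
          ⟨((v i).appIso (v i ⁻¹ᵁ U)).inv ((s i).appLE (φ ⁻¹ᵁ U) (v i ⁻¹ᵁ U) (hsv i) f), ?_⟩
        · intro q hq
          obtain ⟨i, hi⟩ := hv q
          refine TopologicalSpace.Opens.mem_iSup.2 ⟨i, ?_⟩
          rw [(v i).image_preimage_eq_opensRange_inf]
          exact ⟨hi, hq⟩
        refine Scheme.section_ext fun p hp => ?_
        have hp' : φ p ∈ (v i).opensRange := by
          have : φ p ∈ v i ''ᵁ v i ⁻¹ᵁ U := hp
          rw [(v i).image_preimage_eq_opensRange_inf] at this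
          exact this.1
        obtain ⟨O, o, _, r, h, w, hpo, ho⟩ := hloc i p hp'
        refine ⟨O, o, inferInstance, hpo, ?_⟩
        have hor : o ≫ φ = r ≫ v i := by
          rw [← ho, Category.assoc, hσ, pullback.lift_snd_assoc, Category.assoc, hs]
        set M := o ⁻¹ᵁ φ ⁻¹ᵁ v i ''ᵁ v i ⁻¹ᵁ U with hM
        have hMr : M ≤ r ⁻¹ᵁ v i ⁻¹ᵁ U := by
          rw [hM, ← Scheme.Hom.comp_preimage, ← Scheme.Hom.comp_preimage, ← hor]
          exact (o ≫ φ).preimage_mono (hle i)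
        have hMU : M ≤ o ⁻¹ᵁ φ ⁻¹ᵁ U := o.preimage_mono (φ.preimage_mono (hle i))
        have hMl : M ≤ pullback.lift h (r ≫ s i) w ⁻¹ᵁ pullback.snd g x ⁻¹ᵁ φ ⁻¹ᵁ U := by
          rw [← Scheme.Hom.comp_preimage, pullback.lift_snd, Scheme.Hom.comp_preimage]
          exact hMr.trans (r.preimage_mono (hsv i))
        have hlhs : (v i).appLE (v i ''ᵁ v i ⁻¹ᵁ U) (v i ⁻¹ᵁ U)
            ((v i).preimage_image_eq _).ge
            (((v i).appIso (v i ⁻¹ᵁ U)).inv ((s i).appLE (φ ⁻¹ᵁ U) (v i ⁻¹ᵁ U) (hsv i) f)) =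
            (s i).appLE (φ ⁻¹ᵁ U) (v i ⁻¹ᵁ U) (hsv i) f := by
          rw [← CommRingCat.comp_apply, Scheme.Hom.appIso_inv_appLE]
          exact ConcreteCategory.congr_hom ((V i).presheaf.map_id _) _
        have hrhs := congrArg ((pullback.lift h (r ≫ s i) w).appLE _ M hMl) hf
        rw [Scheme.Hom.app_eq_appLE, ← CommRingCat.comp_apply, ← CommRingCat.comp_apply,
          Scheme.Hom.appLE_comp_appLE, Scheme.Hom.appLE_comp_appLE, Scheme.appLE_congr_hom ho,
          Scheme.appLE_congr_hom (pullback.lift_snd h (r ≫ s i) w),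
          ← Scheme.Hom.appLE_comp_appLE _ _ _ (v i ⁻¹ᵁ U) _ (hsv i) hMr, CommRingCat.comp_apply,
          ← hlhs, ← CommRingCat.comp_apply, Scheme.Hom.appLE_comp_appLE,
          Scheme.appLE_congr_hom hor.symm] at hrhs
        have h₁ (t : Γ(Q, v i ''ᵁ v i ⁻¹ᵁ U)) :
            o.app (φ ⁻¹ᵁ v i ''ᵁ v i ⁻¹ᵁ U) (φ.app (v i ''ᵁ v i ⁻¹ᵁ U) t) =
              (o ≫ φ).appLE (v i ''ᵁ v i ⁻¹ᵁ U) M le_rfl t := by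
          rw [Scheme.Hom.app_eq_appLE, Scheme.Hom.app_eq_appLE, ← CommRingCat.comp_apply,
            Scheme.Hom.appLE_comp_appLE]
        refine (h₁ _).trans (hrhs.symm.trans ?_)
        rw [Scheme.Hom.app_eq_appLE, ← CommRingCat.comp_apply, Scheme.Hom.map_appLE] }

theorem epi_of_local_sections {X Q : Scheme.{0}} (φ : X ⟶ Q) {ι : Type*} {V : ι → Scheme.{0}}
    (v : ∀ i, V i ⟶ Q) [∀ i, IsOpenImmersion (v i)] (hv : ∀ q, ∃ i, q ∈ (v i).opensRange)
    (s : ∀ i, V i ⟶ X) (hs : ∀ i, s i ≫ φ = v i) : Epi φ := by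
  refine ⟨fun a b h => ?_⟩
  let 𝒰 : Q.OpenCover := .mkOfCovers ι V v hv inferInstance
  refine Scheme.Cover.hom_ext 𝒰 _ _ fun i => ?_
  exact (congrArg (· ≫ a) (hs i).symm).trans ((Category.assoc _ _ _).trans
    ((congrArg (s i ≫ ·) h).trans ((Category.assoc _ _ _).symm.trans (congrArg (· ≫ b) (hs i)))))

namespace Conifold

/-! ### Integrality of the coordinate rings -/

theorem irreducible_equation : Irreducible equation := by
  let c : Fin 2 →₀ ℂ := Finsupp.equivFunOnFinite.symm ![1, -1]
  have h : Irreducible (MvPolynomial.sumSMulXSMulY c) := by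
    refine MvPolynomial.irreducible_sumSMulXSMulY c ?_ fun r hr => ?_
    · exact ⟨0, by simp [c], 1, by simp [c], by simp⟩
    · exact isUnit_of_dvd_one (by simpa [c] using hr 0)
  let f : Fin 2 ⊕ Fin 2 → Fin 4 := Sum.elim ![0, 2] ![1, 3]
  have hf : Function.Bijective f := by decide
  rw [← MulEquiv.irreducible_iff (MvPolynomial.renameEquiv ℂ (Equiv.ofBijective f hf))] at h
  convert h using 1
  simp [MvPolynomial.sumSMulXSMulY, Finsupp.linearCombination_apply, Finsupp.sum_fintype, c, f,
    equation, sub_eq_add_neg]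

instance : IsDomain CoordRing :=
  (Ideal.Quotient.isDomain_iff_prime _).2
    ((Ideal.span_singleton_prime irreducible_equation.ne_zero).2 irreducible_equation.prime)

theorem z_ne_zero (i : Fin 4) : z i ≠ 0 := by
  intro h
  rw [z, Ideal.Quotient.eq_zero_iff_mem, Ideal.mem_span_singleton] at h
  have h' := map_dvd (MvPolynomial.aeval (R := ℂ) (Pi.single i (1 : ℂ))) h
  fin_cases i <;> simp [equation] at h'

theorem z_equation : z 0 * z 1 = z 2 * z 3 := by
  have h : Ideal.Quotient.mk (Ideal.span {equation}) equation = 0 :=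
    Ideal.Quotient.eq_zero_iff_mem.2 (Ideal.mem_span_singleton_self _)
  rwa [equation, map_sub, map_mul, map_mul, sub_eq_zero] at h

theorem det_ne_zero : (Matrix.mvPolynomialX (Fin 2) (Fin 2) ℂ).det ≠ 0 :=
  Matrix.det_mvPolynomialX_ne_zero _ _

instance (A : Type) [CommRing A] [Algebra ℂ A] [IsDomain A] : IsDomain (GLRing ⊗[ℂ] A) := by
  let P := MvPolynomial (Fin 2 × Fin 2) ℂ
  let f : P ⊗[ℂ] A →ₐ[ℂ] GLRing ⊗[ℂ] A :=
    Algebra.TensorProduct.map (IsScalarTower.toAlgHom ℂ P GLRing) (AlgHom.id ℂ A)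
  have : IsDomain (A ⊗[ℂ] P) := MvPolynomial.scalarRTensorAlgEquiv.toMulEquiv.isDomain _
  have : IsDomain (P ⊗[ℂ] A) := (Algebra.TensorProduct.comm ℂ P A).toMulEquiv.isDomain _
  let := f.toRingHom.toAlgebra
  have : IsScalarTower P (P ⊗[ℂ] A) (GLRing ⊗[ℂ] A) := .of_algebraMap_eq fun x => by
    change algebraMap P GLRing x ⊗ₜ[ℂ] (1 : A) = f (x ⊗ₜ[ℂ] 1)
    simp [f]
  have := IsLocalization.tensorProduct_tensorProduct ℂ A
    (Submonoid.powers (Matrix.mvPolynomialX (Fin 2) (Fin 2) ℂ).det) GLRing (by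
      ext x
      change f (1 ⊗ₜ[ℂ] x) = 1 ⊗ₜ[ℂ] x
      simp [f])
  refine IsLocalization.isDomain_of_le_nonZeroDivisors (M := Algebra.algebraMapSubmonoid
    (P ⊗[ℂ] A) (Submonoid.powers (Matrix.mvPolynomialX (Fin 2) (Fin 2) ℂ).det)) _ ?_
  rintro _ ⟨_, ⟨n, rfl⟩, rfl⟩
  refine mem_nonZeroDivisors_of_ne_zero fun h => ?_
  exact pow_ne_zero n det_ne_zero ((map_eq_zero_iff _ (Algebra.TensorProduct.includeLeft_injective
    (S := ℂ) (FaithfulSMul.algebraMap_injective ℂ A))).1 h)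

/-! ### Points of the group and of the representation scheme -/

section Points

variable {A : Type} [CommRing A] [Algebra ℂ A]

theorem repHom_ext {f g : RepRing →ₐ[ℂ] A} (h : ∀ i, (univ i).map f = (univ i).map g) : f = g := by
  have h' : f.comp repMk = g.comp repMk := by
    ext ⟨i, a, b⟩
    exact congrFun (congrFun (h i) a) b
  ext x
  obtain ⟨x, rfl⟩ := Ideal.Quotient.mk_surjective x
  exact congrArg (· x) h'

/-- The `A`-valued point of `GL₂` given by an invertible matrix. -/
def glLift (M : Matrix (Fin 2) (Fin 2) A) (hM : IsUnit M.det) : GLRing →ₐ[ℂ] A :=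
  IsLocalization.liftAlgHom (M := Submonoid.powers (Matrix.mvPolynomialX (Fin 2) (Fin 2) ℂ).det)
    (f := MvPolynomial.aeval fun p : Fin 2 × Fin 2 => M p.1 p.2) (by
      rintro ⟨_, n, rfl⟩
      simp only [map_pow]
      refine IsUnit.pow n ?_
      rw [AlgHom.map_det]
      convert hM
      ext i j
      simp)

theorem univGL_map_glLift (M : Matrix (Fin 2) (Fin 2) A) (hM : IsUnit M.det) :
    univGL.map (glLift M hM) = M := by
  ext i j
  simp [univGL, glLift]

theorem glHom_ext {f g : GLRing →ₐ[ℂ] A} (h : univGL.map f = univGL.map g) : f = g := by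
  refine IsLocalization.algHom_ext (Submonoid.powers
    (Matrix.mvPolynomialX (Fin 2) (Fin 2) ℂ).det) ?_
  ext ⟨i, j⟩
  exact congrFun (congrFun h i) j

theorem isUnit_det_map (γ : GLRing →ₐ[ℂ] A) : IsUnit (univGL.map γ).det := by
  have h := isUnit_det_univGL.map γ
  rwa [AlgHom.map_det] at h

theorem map_nonsing_inv {S T : Type*} [CommRing S] [CommRing T] (f : S →+* T)
    {M : Matrix (Fin 2) (Fin 2) S} (hM : IsUnit M.det) : M⁻¹.map f = (M.map f)⁻¹ := by
  refine (Matrix.inv_eq_right_inv ?_).symm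
  rw [← Matrix.map_mul, Matrix.mul_nonsing_inv _ hM]
  exact Matrix.map_one _ (map_zero f) (map_one f)

/-- The point `γ · m` of `Rep`. -/
def conjHom (γ : GLRing →ₐ[ℂ] A) (m : RepRing →ₐ[ℂ] A) : RepRing →ₐ[ℂ] A :=
  (Algebra.TensorProduct.lift γ m fun _ _ => Commute.all _ _).comp coaction

theorem univ_map_conjHom (γ : GLRing →ₐ[ℂ] A) (m : RepRing →ₐ[ℂ] A) (i : Fin 4) :
    (univ i).map (conjHom γ m) = univGL.map γ * (univ i).map m * (univGL.map γ)⁻¹ := by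
  let F : GLRing ⊗[ℂ] RepRing →ₐ[ℂ] A := Algebra.TensorProduct.lift γ m fun _ _ => Commute.all _ _
  have h : (univ i).map (conjHom γ m) = ((univ i).map coaction).map F := by
    rw [Matrix.map_map]; rfl
  have h₁ : actG.map F = univGL.map γ := by
    ext a b; simp [actG, F]
  have h₂ : (actX i).map F = (univ i).map m := by
    ext a b; simp [actX, F]
  have h₃ : (actG⁻¹).map F = (actG.map F)⁻¹ := map_nonsing_inv F.toRingHom isUnit_det_actG
  rw [h, coaction, univ_map_repLift, Matrix.map_mul, Matrix.map_mul, h₃, h₁, h₂]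

theorem map_conjHom {A' : Type} [CommRing A'] [Algebra ℂ A'] (f : A →ₐ[ℂ] A') (γ : GLRing →ₐ[ℂ] A)
    (m : RepRing →ₐ[ℂ] A) : f.comp (conjHom γ m) = conjHom (f.comp γ) (f.comp m) := by
  rw [conjHom, conjHom, ← AlgHom.comp_assoc]
  congr 1
  ext <;> simp

theorem conjHom_eq_iff {γ : GLRing →ₐ[ℂ] A} {m m' : RepRing →ₐ[ℂ] A} : conjHom γ m = m' ↔
    ∀ i, univGL.map γ * (univ i).map m = (univ i).map m' * univGL.map γ := by
  have hγ := isUnit_det_map γ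
  constructor
  · rintro rfl i
    rw [univ_map_conjHom, Matrix.mul_assoc, Matrix.nonsing_inv_mul _ hγ, Matrix.mul_one]
  · intro h
    refine repHom_ext fun i => ?_
    rw [univ_map_conjHom, h, Matrix.mul_assoc, Matrix.mul_nonsing_inv _ hγ, Matrix.mul_one]

theorem map_halfTrace (m : RepRing →ₐ[ℂ] A) (i : Fin 4) :
    m (halfTrace i) = algebraMap ℂ A (1 / 2) * ((univ i).map m).trace := by
  rw [halfTrace, map_mul, AlgHom.commutes, AddMonoidHom.map_trace]

theorem conjHom_halfTrace (γ : GLRing →ₐ[ℂ] A) (m : RepRing →ₐ[ℂ] A) (i : Fin 4) :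
    conjHom γ m (halfTrace i) = m (halfTrace i) := by
  rw [map_halfTrace, map_halfTrace, univ_map_conjHom, Matrix.mul_assoc, Matrix.trace_mul_comm,
    Matrix.mul_assoc, Matrix.nonsing_inv_mul _ (isUnit_det_map γ), Matrix.mul_one]

/-- The point of `Rep` with matrices `[aᵢ, εᵢ; 0, aᵢ]`. -/
def utHom (a ε : Fin 4 → A) (ha : a 0 * a 1 = a 2 * a 3)
    (hε : a 0 * ε 1 + ε 0 * a 1 = a 2 * ε 3 + ε 2 * a 3) : RepRing →ₐ[ℂ] A :=
  repLift (fun i => !![a i, ε i; 0, a i])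
    (fun i j => by ext r s; fin_cases r <;> fin_cases s <;> simp <;> ring)
    (by ext r s; fin_cases r <;> fin_cases s <;> simp [ha, hε])

theorem univ_map_utHom (a ε : Fin 4 → A) (ha : a 0 * a 1 = a 2 * a 3)
    (hε : a 0 * ε 1 + ε 0 * a 1 = a 2 * ε 3 + ε 2 * a 3) (i : Fin 4) :
    (univ i).map (utHom a ε ha hε) = !![a i, ε i; 0, a i] :=
  univ_map_repLift _ _ _ i

theorem map_utHom {A' : Type} [CommRing A'] [Algebra ℂ A'] (f : A →ₐ[ℂ] A') (a ε : Fin 4 → A)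
    (ha : a 0 * a 1 = a 2 * a 3) (hε : a 0 * ε 1 + ε 0 * a 1 = a 2 * ε 3 + ε 2 * a 3) :
    f.comp (utHom a ε ha hε) = utHom (fun i => f (a i)) (fun i => f (ε i))
      (by rw [← map_mul, ha, map_mul]) (by simp only [← map_mul, ← map_add, hε]) := by
  refine repHom_ext fun i => ?_
  have h : (univ i).map (f.comp (utHom a ε ha hε)) = ((univ i).map (utHom a ε ha hε)).map f := by
    rw [Matrix.map_map]; rfl
  rw [h, univ_map_utHom, univ_map_utHom]
  ext r s; fin_cases r <;> fin_cases s <;> simp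

theorem utHom_halfTrace (a ε : Fin 4 → A) (ha : a 0 * a 1 = a 2 * a 3)
    (hε : a 0 * ε 1 + ε 0 * a 1 = a 2 * ε 3 + ε 2 * a 3) (i : Fin 4) :
    utHom a ε ha hε (halfTrace i) = a i := by
  rw [map_halfTrace, univ_map_utHom, Matrix.trace_fin_two]
  simp only [Matrix.of_apply, Matrix.cons_val', Matrix.cons_val_zero, Matrix.cons_val_one,
    Matrix.cons_val_fin_one]
  rw [← two_mul, ← mul_assoc, ← map_ofNat (algebraMap ℂ A), ← map_mul]
  norm_num

/-- The `A`-valued point of the conifold with coordinates `aᵢ`. -/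
def coordLift (a : Fin 4 → A) (ha : a 0 * a 1 = a 2 * a 3) : CoordRing →ₐ[ℂ] A :=
  Ideal.Quotient.liftₐ _ (MvPolynomial.aeval a) (by
    suffices h : Ideal.span {equation} ≤ RingHom.ker (MvPolynomial.aeval (R := ℂ) a) from
      fun f hf => h hf
    rw [Ideal.span_singleton_le_iff_mem, RingHom.mem_ker]
    simp [equation, ha])

theorem coordLift_z (a : Fin 4 → A) (ha : a 0 * a 1 = a 2 * a 3) (i : Fin 4) :
    coordLift a ha (z i) = a i :=
  MvPolynomial.aeval_X a i

theorem coordHom_ext {f g : CoordRing →ₐ[ℂ] A} (h : ∀ i, f (z i) = g (z i)) : f = g := by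
  apply Ideal.Quotient.algHom_ext
  ext i
  exact h i

end Points

end Conifold

namespace Conifold

open BlowUp

section Points

variable {A : Type} [CommRing A] [Algebra ℂ A]

/-- The product of two `A`-valued points of `GL₂`. -/
def glMul (γ γ' : GLRing →ₐ[ℂ] A) : GLRing →ₐ[ℂ] A :=
  glLift (univGL.map γ * univGL.map γ') (by
    rw [Matrix.det_mul]; exact (isUnit_det_map γ).mul (isUnit_det_map γ'))

/-- The inverse of an `A`-valued point of `GL₂`. -/
def glInv (γ : GLRing →ₐ[ℂ] A) : GLRing →ₐ[ℂ] A :=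
  glLift (univGL.map γ)⁻¹ (Matrix.isUnit_nonsing_inv_det _ (isUnit_det_map γ))

theorem conjHom_conjHom (γ γ' : GLRing →ₐ[ℂ] A) (m : RepRing →ₐ[ℂ] A) :
    conjHom γ (conjHom γ' m) = conjHom (glMul γ γ') m := by
  refine repHom_ext fun i => ?_
  rw [univ_map_conjHom, univ_map_conjHom, univ_map_conjHom, glMul, univGL_map_glLift,
    Matrix.mul_inv_rev]
  simp only [Matrix.mul_assoc]

theorem glMul_glInv_cancel (γ γ' : GLRing →ₐ[ℂ] A) : glMul (glMul γ' (glInv γ)) γ = γ' := by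
  refine glHom_ext ?_
  rw [glMul, univGL_map_glLift, glMul, univGL_map_glLift, glInv, univGL_map_glLift,
    Matrix.mul_assoc, Matrix.nonsing_inv_mul _ (isUnit_det_map γ), Matrix.mul_one]

end Points

/-- The coordinate ring of `GL₂ × Y`. -/
def Ambient : Type := GLRing ⊗[ℂ] CoordRing

instance : CommRing Ambient := inferInstanceAs (CommRing (GLRing ⊗[ℂ] CoordRing))

instance : Algebra ℂ Ambient := inferInstanceAs (Algebra ℂ (GLRing ⊗[ℂ] CoordRing))

instance : IsDomain Ambient := inferInstanceAs (IsDomain (GLRing ⊗[ℂ] CoordRing))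

/-- The inclusion of `𝒪(GL₂)` in `𝒪(GL₂ × Y)`. -/
def ambLeft : GLRing →ₐ[ℂ] Ambient :=
  (Algebra.TensorProduct.includeLeft : GLRing →ₐ[ℂ] GLRing ⊗[ℂ] CoordRing)

/-- The inclusion of `𝒪(Y)` in `𝒪(GL₂ × Y)`. -/
def ambRight : CoordRing →ₐ[ℂ] Ambient :=
  (Algebra.TensorProduct.includeRight : CoordRing →ₐ[ℂ] GLRing ⊗[ℂ] CoordRing)

theorem nontrivial_GLRing : Nontrivial GLRing :=
  (glLift (1 : Matrix (Fin 2) (Fin 2) ℂ) (by simp)).toRingHom.domain_nontrivial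

theorem ambRight_injective : Function.Injective ambRight :=
  Algebra.TensorProduct.includeRight_injective (R := ℂ) (A := GLRing) (B := CoordRing)
    (have : Nontrivial GLRing := nontrivial_GLRing; (algebraMap ℂ GLRing).injective)

/-- The `A`-valued point of `GL₂ × Y` with given coordinates. -/
def ambLift {A : Type} [CommRing A] [Algebra ℂ A] (γ : GLRing →ₐ[ℂ] A) (y : CoordRing →ₐ[ℂ] A) :
    Ambient →ₐ[ℂ] A :=
  (Algebra.TensorProduct.lift γ y fun _ _ => Commute.all _ _ : GLRing ⊗[ℂ] CoordRing →ₐ[ℂ] A)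

theorem ambLift_comp_left {A : Type} [CommRing A] [Algebra ℂ A] (γ : GLRing →ₐ[ℂ] A)
    (y : CoordRing →ₐ[ℂ] A) : (ambLift γ y).comp ambLeft = γ :=
  Algebra.TensorProduct.lift_comp_includeLeft γ y fun _ _ => Commute.all _ _

theorem ambLift_comp_right {A : Type} [CommRing A] [Algebra ℂ A] (γ : GLRing →ₐ[ℂ] A)
    (y : CoordRing →ₐ[ℂ] A) : (ambLift γ y).comp ambRight = y :=
  Algebra.TensorProduct.lift_comp_includeRight' γ y fun _ _ => Commute.all _ _

/-- A vector field on the conifold, not vanishing identically. -/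
structure VectorField where
  coeff : Fin 4 → CoordRing
  tangent : z 0 * coeff 1 + coeff 0 * z 1 = z 2 * coeff 3 + coeff 2 * z 3
  coeff_zero_ne_zero : coeff 0 ≠ 0

namespace VectorField

variable (v : VectorField)

/-- The section `(z, v(z))` of the tangent scheme. -/
def secHom : RepRing →ₐ[ℂ] CoordRing := utHom z v.coeff z_equation v.tangent

/-- The map `GL₂ × Y ⟶ Rep`, `(g, z) ↦ g (z, v(z)) g⁻¹`. -/
def orbitHom : RepRing →ₐ[ℂ] Ambient :=
  conjHom ambLeft (ambRight.comp v.secHom)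

/-- The coordinate ring of the closure of the image of `GL₂ × Y ⟶ Rep`. -/
def OrbitRing : Type := RepRing ⧸ RingHom.ker v.orbitHom

instance : CommRing v.OrbitRing := inferInstanceAs (CommRing (RepRing ⧸ RingHom.ker v.orbitHom))

instance : Algebra ℂ v.OrbitRing :=
  inferInstanceAs (Algebra ℂ (RepRing ⧸ RingHom.ker v.orbitHom))

/-- The quotient map to the coordinate ring of the orbit closure. -/
def orbitMk : RepRing →ₐ[ℂ] v.OrbitRing := Ideal.Quotient.mkₐ ℂ (RingHom.ker v.orbitHom)

theorem orbitMk_surjective : Function.Surjective v.orbitMk := Ideal.Quotient.mk_surjective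

theorem orbitMk_eq_zero {x : RepRing} : v.orbitMk x = 0 ↔ v.orbitHom x = 0 :=
  Ideal.Quotient.eq_zero_iff_mem

/-- Maps from the coordinate ring of the orbit closure. -/
def orbitLift {A : Type} [CommRing A] [Algebra ℂ A] (f : RepRing →ₐ[ℂ] A)
    (hf : ∀ x, v.orbitHom x = 0 → f x = 0) : v.OrbitRing →ₐ[ℂ] A :=
  Ideal.Quotient.liftₐ (RingHom.ker v.orbitHom) f hf

theorem orbitLift_comp {A : Type} [CommRing A] [Algebra ℂ A] (f : RepRing →ₐ[ℂ] A)
    (hf : ∀ x, v.orbitHom x = 0 → f x = 0) : (v.orbitLift f hf).comp v.orbitMk = f := by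
  ext x; rfl

/-- The inclusion of the coordinate ring of the orbit closure in `𝒪(GL₂ × Y)`. -/
def inc : v.OrbitRing →ₐ[ℂ] Ambient := v.orbitLift v.orbitHom fun _ h => h

theorem inc_orbitMk (x : RepRing) : v.inc (v.orbitMk x) = v.orbitHom x := rfl

theorem inc_injective : Function.Injective v.inc := by
  rw [injective_iff_map_eq_zero]
  intro x hx
  obtain ⟨x, rfl⟩ := v.orbitMk_surjective x
  exact v.orbitMk_eq_zero.2 hx

instance : IsDomain v.OrbitRing := v.inc_injective.isDomain v.inc.toRingHom

theorem orbitHom_halfTrace (i : Fin 4) : v.orbitHom (halfTrace i) = ambRight (z i) := by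
  rw [orbitHom, conjHom_halfTrace, AlgHom.comp_apply, secHom, utHom_halfTrace]

/-- The center of mass, as a map to the conifold. -/
def center : CoordRing →ₐ[ℂ] v.OrbitRing :=
  coordLift (fun i => v.orbitMk (halfTrace i)) (by
    apply v.inc_injective
    simp only [map_mul, inc_orbitMk, orbitHom_halfTrace]
    rw [← map_mul, z_equation, map_mul])

theorem center_z (i : Fin 4) : v.center (z i) = v.orbitMk (halfTrace i) := coordLift_z _ _ i

theorem inc_comp_center : v.inc.comp v.center = ambRight :=
  coordHom_ext fun i => by
    rw [AlgHom.comp_apply, center_z, inc_orbitMk, orbitHom_halfTrace]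

theorem inc_center (x : CoordRing) : v.inc (v.center x) = ambRight x :=
  congrArg (· x) v.inc_comp_center

theorem center_injective : Function.Injective v.center := by
  refine .of_comp (f := v.inc) ?_
  rw [← AlgHom.coe_comp, inc_comp_center]
  exact ambRight_injective

/-- The nilpotent part of the universal representation. -/
def nil (i : Fin 4) : Matrix (Fin 2) (Fin 2) v.OrbitRing :=
  (univ i).map v.orbitMk - Matrix.scalar (Fin 2) (v.center (z i))

/-- The universal conjugate of the elementary nilpotent matrix. -/
def conjNil : Matrix (Fin 2) (Fin 2) (Ambient) :=
  univGL.map ambLeft *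
    !![0, 1; 0, 0] *
  (univGL.map ambLeft)⁻¹

theorem trace_conjNil : conjNil.trace = 0 := by
  rw [conjNil, Matrix.mul_assoc, Matrix.trace_mul_comm, Matrix.mul_assoc,
    Matrix.nonsing_inv_mul _ (isUnit_det_map _), Matrix.mul_one]
  simp [Matrix.trace_fin_two]

theorem det_conjNil : conjNil.det = 0 := by
  rw [conjNil, Matrix.det_mul, Matrix.det_mul]
  simp [Matrix.det_fin_two]

theorem inc_nil (i : Fin 4) (a b : Fin 2) :
    v.inc (v.nil i a b) = (ambRight (v.coeff i)) * conjNil a b := by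
  have h : (v.nil i).map v.inc = (ambRight (v.coeff i)) • conjNil := by
    have h₁ : (v.nil i).map v.inc = (univ i).map v.orbitHom -
        Matrix.scalar (Fin 2) (ambRight (z i)) := by
      ext a b
      rw [nil, Matrix.map_apply, Matrix.sub_apply, map_sub, Matrix.map_apply, inc_orbitMk,
        Matrix.sub_apply, Matrix.map_apply, Matrix.scalar_apply, Matrix.scalar_apply,
        ← v.inc_center]
      simp [Matrix.diagonal_apply, apply_ite v.inc]
    have h₂ : (univ i).map (ambRight.comp v.secHom) =
        Matrix.scalar (Fin 2) (ambRight (z i)) +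
          (ambRight (v.coeff i)) • !![0, 1; 0, 0] := by
      rw [secHom, map_utHom, univ_map_utHom]
      ext a b; fin_cases a <;> fin_cases b <;> simp
    rw [h₁, orbitHom, univ_map_conjHom, h₂, conjNil, Matrix.mul_add, Matrix.add_mul,
      ← Matrix.scalar_comm _ (Commute.all _), Matrix.mul_assoc (Matrix.scalar _ _),
      Matrix.mul_nonsing_inv _ (isUnit_det_map _), Matrix.mul_one, add_sub_cancel_left,
      Matrix.mul_smul, Matrix.smul_mul]
  exact congrFun (congrFun h a) b

theorem center_mul_nil (i j : Fin 4) (a b : Fin 2) :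
    v.center (v.coeff j) * v.nil i a b = v.center (v.coeff i) * v.nil j a b := by
  apply v.inc_injective
  simp only [map_mul, inc_center, inc_nil]
  ring

theorem nil_one_one (i : Fin 4) : v.nil i 1 1 = -v.nil i 0 0 := by
  have h := trace_conjNil
  rw [Matrix.trace_fin_two] at h
  apply v.inc_injective
  simp only [map_neg, inc_nil]
  linear_combination (ambRight (v.coeff i)) * h

theorem nil_sq (i : Fin 4) : v.nil i 0 0 * v.nil i 0 0 + v.nil i 0 1 * v.nil i 1 0 = 0 := by
  have h := trace_conjNil
  have h' := det_conjNil
  rw [Matrix.trace_fin_two] at h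
  rw [Matrix.det_fin_two] at h'
  apply v.inc_injective
  simp only [map_add, map_mul, map_zero, inc_nil]
  linear_combination (ambRight (v.coeff i)) ^ 2 * (conjNil 0 0 * h - h')

/-- The off-diagonal entries of the nilpotent part. -/
def offDiag (j : Fin 4) : Bool → v.OrbitRing
  | true => v.nil j 0 1
  | false => v.nil j 1 0

theorem coeff_ne_zero_of_offDiag {j : Fin 4} {k : Bool} (h : v.offDiag j k ≠ 0) :
    v.coeff j ≠ 0 := by
  contrapose! h
  apply v.inc_injective
  cases k <;> simp [offDiag, inc_nil, h]

/-- A nilpotent matrix with an invertible entry is conjugate to the elementary one. -/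
theorem exists_conj_of_isUnit {S : Type*} [CommRing S] {x y w : S} (h : x * x + y * w = 0)
    (hu : IsUnit y ∨ IsUnit w) : ∃ M : Matrix (Fin 2) (Fin 2) S, IsUnit M.det ∧
      M * !![0, 1; 0, 0] = !![x, y; w, -x] * M := by
  obtain hu | hu := hu
  · refine ⟨!![y, 0; -x, 1], by simpa using hu, ?_⟩
    ext a b; fin_cases a <;> fin_cases b <;> simp
    · ring
    · linear_combination -h
  · refine ⟨!![x, 1; w, 0], by simpa using hu, ?_⟩
    ext a b; fin_cases a <;> fin_cases b <;> simp
    · linear_combination -h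
    · ring

/-- The ideal of the zero locus of the vector field. -/
def ideal : Ideal CoordRing := Ideal.span (Set.range v.coeff)

/-- The generators of the ideal of the zero locus. -/
def gen (j : Fin 4) : v.ideal := ⟨v.coeff j, Ideal.subset_span ⟨j, rfl⟩⟩

theorem span_gen : Ideal.span (Set.range fun j : {j // v.coeff j ≠ 0} => (v.gen j : CoordRing)) =
    v.ideal := by
  refine le_antisymm (Ideal.span_le.2 ?_) (Ideal.span_le.2 ?_)
  · rintro _ ⟨j, rfl⟩
    exact (v.gen j).2
  · rintro _ ⟨j, rfl⟩
    by_cases hj : v.coeff j = 0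
    · rw [hj]; exact Ideal.zero_mem _
    · exact Ideal.subset_span ⟨⟨j, hj⟩, rfl⟩

end VectorField

end Conifold

theorem Scheme.ker_comp_of_isDominant {X Y Z : Scheme.{0}} (f : X ⟶ Y) (g : Y ⟶ Z) [IsDominant f]
    [QuasiCompact f] [QuasiCompact g] [IsReduced Y] : (f ≫ g).ker = g.ker := by
  have := IsSchemeTheoreticallyDominant.of_isDominant f
  rw [Scheme.Hom.ker_comp, f.ker_eq_bot, Scheme.IdealSheafData.map_bot]

theorem isOpenImmersion_pullback_lift {G X U S : Scheme.{0}} {g : G ⟶ S} {x : X ⟶ S} {y : U ⟶ S}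
    (u : U ⟶ X) [IsOpenImmersion u] (h : u ≫ x = y) (w : pullback.fst g y ≫ g =
      (pullback.snd g y ≫ u) ≫ x) :
    IsOpenImmersion (pullback.lift (pullback.fst g y) (pullback.snd g y ≫ u) w) := by
  subst h
  have h₁ : IsPullback (pullback.lift (pullback.fst g (u ≫ x)) (pullback.snd g (u ≫ x) ≫ u) w)
      (pullback.snd g (u ≫ x)) (pullback.snd g x) u :=
    IsPullback.of_right (h₁₂ := pullback.fst g x) (h₂₂ := x) (v₁₃ := g)
      ((pullback.lift_fst _ _ w).symm ▸ (IsPullback.of_hasPullback g (u ≫ x)).flip.flip)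
      (pullback.lift_snd _ _ w) (IsPullback.of_hasPullback g x)
  exact MorphismProperty.of_isPullback (P := @IsOpenImmersion) h₁.flip inferInstance

namespace Conifold

section Spec

/-- The morphism of spectra of a map of `ℂ`-algebras. -/
abbrev specMap {A B : Type} [CommRing A] [Algebra ℂ A] [CommRing B] [Algebra ℂ B] (f : A →ₐ[ℂ] B) :
    Spec (.of B) ⟶ Spec (.of A) :=
  Spec.map (CommRingCat.ofHom f.toRingHom)

/-- The structure morphism of the spectrum of a `ℂ`-algebra. -/
abbrev specStr (A : Type) [CommRing A] [Algebra ℂ A] : Spec (.of A) ⟶ Spec (.of ℂ) :=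
  Spec.map (CommRingCat.ofHom (algebraMap ℂ A))

variable {A B C : Type} [CommRing A] [Algebra ℂ A] [CommRing B] [Algebra ℂ B] [CommRing C]
  [Algebra ℂ C]

theorem specMap_comp (f : A →ₐ[ℂ] B) (g : B →ₐ[ℂ] C) :
    specMap g ≫ specMap f = specMap (g.comp f) :=
  (Spec.map_comp _ _).symm

theorem specMap_str (f : A →ₐ[ℂ] B) : specMap f ≫ specStr A = specStr B := by
  rw [specStr, specMap, ← Spec.map_comp, ← CommRingCat.ofHom_comp]
  congr 2
  exact f.comp_algebraMap

theorem exists_eq_specMap (f : Spec (.of B) ⟶ Spec (.of A)) (hf : f ≫ specStr A = specStr B) :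
    ∃ φ : A →ₐ[ℂ] B, f = specMap φ := by
  obtain ⟨φ, rfl⟩ := Spec.map_surjective f
  rw [specStr, ← Spec.map_comp] at hf
  exact ⟨⟨φ.hom, fun r => congrArg (fun k => k.hom r) (Spec.map_injective hf)⟩, rfl⟩

theorem isDominant_specMap {f : A →ₐ[ℂ] B} (hf : Function.Injective f) :
    IsDominant (specMap f) := by
  refine ⟨?_⟩
  exact (PrimeSpectrum.denseRange_comap_iff_ker_le_nilRadical _).2
    (((RingHom.injective_iff_ker_eq_bot f.toRingHom).1 hf).le.trans bot_le)

theorem pullback_lift_specMap (γ : A →ₐ[ℂ] C) (m : B →ₐ[ℂ] C)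
    (w : specMap γ ≫ specStr A = specMap m ≫ specStr B) :
    pullback.lift (specMap γ) (specMap m) w =
      specMap (Algebra.TensorProduct.lift γ m fun _ _ => Commute.all _ _) ≫
        (pullbackSpecIso ℂ A B).inv := by
  refine pullback.hom_ext ?_ ?_
  · refine (pullback.lift_fst _ _ _).trans (Eq.trans ?_ (Category.assoc _ _ _).symm)
    refine Eq.trans ?_ (congrArg (_ ≫ ·) (pullbackSpecIso_inv_fst ℂ A B).symm)
    refine Eq.trans ?_ (Spec.map_comp _ _)
    refine congrArg Spec.map (CommRingCat.hom_ext (RingHom.ext fun x => ?_))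
    exact (congrArg (· x) (Algebra.TensorProduct.lift_comp_includeLeft γ m
      fun _ _ => Commute.all _ _)).symm
  · refine (pullback.lift_snd _ _ _).trans (Eq.trans ?_ (Category.assoc _ _ _).symm)
    refine Eq.trans ?_ (congrArg (_ ≫ ·) (pullbackSpecIso_inv_snd ℂ A B).symm)
    refine Eq.trans ?_ (Spec.map_comp _ _)
    refine congrArg Spec.map (CommRingCat.hom_ext (RingHom.ext fun x => ?_))
    exact (congrArg (· x) (Algebra.TensorProduct.lift_comp_includeRight' γ m
      fun _ _ => Commute.all _ _)).symm

theorem lift_action (γ : GLRing →ₐ[ℂ] A) (m : RepRing →ₐ[ℂ] A)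
    (w : specMap γ ≫ strGL = specMap m ≫ strRep) :
    pullback.lift (specMap γ) (specMap m) w ≫ action = specMap (conjHom γ m) := by
  rw [pullback_lift_specMap, action, Category.assoc, Iso.inv_hom_id_assoc]
  exact (Spec.map_comp _ _).symm

theorem prodMap_fst {X : Scheme.{0}} (j : X ⟶ Rep) :
    prodMap j ≫ pullback.fst strGL strRep = pullback.fst strGL (j ≫ strRep) :=
  (pullback.lift_fst _ _ _).trans (Category.comp_id _)

theorem prodMap_snd {X : Scheme.{0}} (j : X ⟶ Rep) :
    prodMap j ≫ pullback.snd strGL strRep = pullback.snd strGL (j ≫ strRep) ≫ j :=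
  pullback.lift_snd _ _ _

theorem lift_prodMap_action {X T : Scheme.{0}} (j : X ⟶ Rep) (a : T ⟶ GL₂) (t : T ⟶ X)
    (w : a ≫ strGL = t ≫ j ≫ strRep) : pullback.lift a t w ≫ prodMap j ≫ action =
      pullback.lift a (t ≫ j) (w.trans (Category.assoc _ _ _).symm) ≫ action := by
  rw [← Category.assoc]
  refine congrArg (· ≫ action) (pullback.hom_ext ?_ ?_)
  · refine (Category.assoc _ _ _).trans ((congrArg (_ ≫ ·) (prodMap_fst _)).trans ?_)
    exact (pullback.lift_fst _ _ _).trans (pullback.lift_fst _ _ _).symm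
  · refine (Category.assoc _ _ _).trans ((congrArg (_ ≫ ·) (prodMap_snd _)).trans ?_)
    refine (Category.assoc _ _ _).symm.trans ((congrArg (· ≫ j) (pullback.lift_snd _ _ _)).trans ?_)
    exact (pullback.lift_snd _ _ _).symm

end Spec

namespace VectorField

variable (v : VectorField)

/-- The orbit closure as a closed subscheme of `Rep`. -/
abbrev embed : Spec (.of v.OrbitRing) ⟶ Rep := specMap v.orbitMk

instance : IsClosedImmersion v.embed := IsClosedImmersion.spec_of_surjective _ v.orbitMk_surjective

/-- The map `𝒪(W_ut) → 𝒪(Y)` of the section. -/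
def utSec : WutRing →ₐ[ℂ] CoordRing := Ideal.Quotient.liftₐ utIdeal v.secHom (by
  suffices h : utIdeal ≤ RingHom.ker v.secHom from fun f hf => h hf
  rw [utIdeal, Ideal.span_le]
  have hM (i : Fin 4) (a b : Fin 2) : v.secHom (univ i a b) = !![z i, v.coeff i; 0, z i] a b :=
    congrFun (congrFun (univ_map_utHom z v.coeff z_equation v.tangent i) a) b
  rintro _ (⟨i, rfl⟩ | ⟨i, rfl⟩)
  · exact hM i 1 0
  · rw [SetLike.mem_coe, RingHom.mem_ker, map_sub, hM, hM]
    exact sub_self _)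

theorem utSec_comp : v.utSec.comp utMk = v.secHom := by ext x; rfl

theorem inc_comp_orbitMk : v.inc.comp v.orbitMk = v.orbitHom := by ext x; rfl

theorem ker_sweep_le : Wι.ker ≤ v.embed.ker := by
  have hw : specMap ambLeft ≫ strGL = specMap (ambRight.comp v.utSec) ≫ Wutι ≫ strRep := by
    rw [specMap_str]
    exact ((congrArg (_ ≫ ·) (specMap_str utMk)).trans (specMap_str _)).symm
  have h : pullback.lift (specMap ambLeft) (specMap (ambRight.comp v.utSec)) hw ≫ sweep =
      specMap v.inc ≫ v.embed := by
    rw [specMap_comp, inc_comp_orbitMk, orbitHom, sweep]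
    refine (lift_prodMap_action Wutι _ _ hw).trans ?_
    rw [← lift_action _ _ ((specMap_str _).trans (specMap_str _).symm)]
    congr 2
    rw [specMap_comp, AlgHom.comp_assoc, utSec_comp]
  have := isDominant_specMap v.inc_injective
  rw [← Scheme.ker_comp_of_isDominant (specMap v.inc) v.embed, ← h]
  refine le_trans ?_ (Scheme.Hom.le_ker_comp _ _)
  rw [Scheme.IdealSheafData.ker_subschemeι]

/-- The inclusion of the orbit closure in `W`. -/
def toW : Spec (.of v.OrbitRing) ⟶ W := IsClosedImmersion.lift Wι v.embed v.ker_sweep_le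

theorem toW_comp : v.toW ≫ Wι = v.embed := IsClosedImmersion.lift_fac _ _ _

instance : IsClosedImmersion v.toW :=
  have : IsClosedImmersion (v.toW ≫ Wι) := v.toW_comp ▸ inferInstance
  IsClosedImmersion.of_comp_isClosedImmersion v.toW Wι

/-- The locus where the nilpotent part does not vanish. -/
def locus : (Spec (.of v.OrbitRing)).Opens :=
  ⨆ p : Fin 4 × Fin 2 × Fin 2, PrimeSpectrum.basicOpen (v.nil p.1 p.2.1 p.2.2)

theorem mem_locus {x : PrimeSpectrum v.OrbitRing} :
    x ∈ v.locus ↔ ∃ i a b, v.nil i a b ∉ x.asIdeal := by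
  refine TopologicalSpace.Opens.mem_iSup.trans ?_
  simp [Prod.exists]

/-- The coaction on the orbit closure. -/
def orbitCoaction : v.OrbitRing →ₐ[ℂ] GLRing ⊗[ℂ] v.OrbitRing :=
  v.orbitLift (conjHom Algebra.TensorProduct.includeLeft
    (Algebra.TensorProduct.includeRight.comp v.orbitMk)) (by
    intro x hx
    let J : GLRing ⊗[ℂ] v.OrbitRing →ₐ[ℂ] GLRing ⊗[ℂ] Ambient :=
      Algebra.TensorProduct.map (AlgHom.id ℂ GLRing) v.inc
    have hJ : Function.Injective J := Module.Flat.lTensor_preserves_injective_linearMap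
      (M := GLRing) v.inc.toLinearMap v.inc_injective
    have hJl : J.comp Algebra.TensorProduct.includeLeft = Algebra.TensorProduct.includeLeft := by
      ext; simp [J]
    have hJr : J.comp Algebra.TensorProduct.includeRight =
        Algebra.TensorProduct.includeRight.comp v.inc := by
      ext; simp [J]
    have h : J.comp (conjHom Algebra.TensorProduct.includeLeft
        (Algebra.TensorProduct.includeRight.comp v.orbitMk)) =
        (ambLift (glMul Algebra.TensorProduct.includeLeft
          (Algebra.TensorProduct.includeRight.comp ambLeft))
          (Algebra.TensorProduct.includeRight.comp ambRight)).comp v.orbitHom := by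
      rw [map_conjHom, hJl, ← AlgHom.comp_assoc, hJr, AlgHom.comp_assoc, inc_comp_orbitMk, orbitHom,
        map_conjHom, map_conjHom, conjHom_conjHom, ambLift_comp_left, ← AlgHom.comp_assoc,
        ← AlgHom.comp_assoc, ambLift_comp_right]
    apply hJ
    refine (congrArg (· x) h).trans ?_
    change ambLift _ _ (v.orbitHom x) = _
    rw [hx, map_zero, map_zero])

theorem orbitCoaction_comp : v.orbitCoaction.comp v.orbitMk =
    conjHom Algebra.TensorProduct.includeLeft
      (Algebra.TensorProduct.includeRight.comp v.orbitMk) :=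
  v.orbitLift_comp _ _

theorem orbitCoaction_center (x : CoordRing) :
    v.orbitCoaction (v.center x) = 1 ⊗ₜ[ℂ] v.center x := by
  have h : v.orbitCoaction.comp v.center =
      (Algebra.TensorProduct.includeRight : v.OrbitRing →ₐ[ℂ] GLRing ⊗[ℂ] v.OrbitRing).comp
        v.center :=
    coordHom_ext fun i => by
      rw [AlgHom.comp_apply, center_z, ← AlgHom.comp_apply, orbitCoaction_comp, conjHom_halfTrace,
        AlgHom.comp_apply, AlgHom.comp_apply, center_z]
  exact congrArg (· x) h

/-- The equivariance of the nilpotent part. -/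
theorem orbitCoaction_nil_mul (i : Fin 4) : (v.nil i).map v.orbitCoaction *
      univGL.map (Algebra.TensorProduct.includeLeft : GLRing →ₐ[ℂ] GLRing ⊗[ℂ] v.OrbitRing) =
    univGL.map (Algebra.TensorProduct.includeLeft : GLRing →ₐ[ℂ] GLRing ⊗[ℂ] v.OrbitRing) *
      (v.nil i).map (Algebra.TensorProduct.includeRight :
        v.OrbitRing →ₐ[ℂ] GLRing ⊗[ℂ] v.OrbitRing) := by
  have h := conjHom_eq_iff.1 v.orbitCoaction_comp.symm i
  have h₁ : (v.nil i).map v.orbitCoaction = (univ i).map (v.orbitCoaction.comp v.orbitMk) -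
      Matrix.scalar (Fin 2) ((1 : GLRing) ⊗ₜ[ℂ] v.center (z i)) := by
    ext a b
    rw [nil, Matrix.map_apply, Matrix.sub_apply, map_sub, Matrix.map_apply, Matrix.sub_apply,
      Matrix.map_apply, Matrix.scalar_apply, Matrix.scalar_apply, ← orbitCoaction_center]
    simp [Matrix.diagonal_apply, apply_ite v.orbitCoaction]
  have h₂ : (v.nil i).map (Algebra.TensorProduct.includeRight :
        v.OrbitRing →ₐ[ℂ] GLRing ⊗[ℂ] v.OrbitRing) =
      (univ i).map ((Algebra.TensorProduct.includeRight :
        v.OrbitRing →ₐ[ℂ] GLRing ⊗[ℂ] v.OrbitRing).comp v.orbitMk) -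
      Matrix.scalar (Fin 2) ((1 : GLRing) ⊗ₜ[ℂ] v.center (z i)) := by
    ext a b
    rw [nil, Matrix.map_apply, Matrix.sub_apply, map_sub, Matrix.map_apply, Matrix.sub_apply,
      Matrix.map_apply, Matrix.scalar_apply, Matrix.scalar_apply,
      ← Algebra.TensorProduct.includeRight_apply]
    by_cases hab : a = b <;> simp [hab]
  rw [h₁, h₂, Matrix.mul_sub, Matrix.sub_mul, h, ← Matrix.scalar_comm _ (Commute.all _)]

theorem preimage_locus (x : PrimeSpectrum (GLRing ⊗[ℂ] v.OrbitRing))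
    (hx : specMap (Algebra.TensorProduct.includeRight :
      v.OrbitRing →ₐ[ℂ] GLRing ⊗[ℂ] v.OrbitRing) x ∈ v.locus) :
    specMap v.orbitCoaction x ∈ v.locus := by
  obtain ⟨i, a, b, h⟩ := v.mem_locus.1 hx
  by_contra h'
  have h₀ (c d : Fin 2) : v.orbitCoaction (v.nil i c d) ∈ x.asIdeal := by
    by_contra h₀
    exact h' (v.mem_locus.2 ⟨i, c, d, h₀⟩)
  refine h ?_
  change (Algebra.TensorProduct.includeRight :
      v.OrbitRing →ₐ[ℂ] GLRing ⊗[ℂ] v.OrbitRing) (v.nil i a b) ∈ x.asIdeal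
  have e := v.orbitCoaction_nil_mul i
  set G := univGL.map
    (Algebra.TensorProduct.includeLeft : GLRing →ₐ[ℂ] GLRing ⊗[ℂ] v.OrbitRing) with hG
  have e' : (v.nil i).map (Algebra.TensorProduct.includeRight :
        v.OrbitRing →ₐ[ℂ] GLRing ⊗[ℂ] v.OrbitRing) =
      G⁻¹ * ((v.nil i).map v.orbitCoaction * G) := by
    rw [e, ← Matrix.mul_assoc, Matrix.nonsing_inv_mul _ (isUnit_det_map _), Matrix.one_mul]
  rw [← Matrix.map_apply (f := (Algebra.TensorProduct.includeRight :
    v.OrbitRing →ₐ[ℂ] GLRing ⊗[ℂ] v.OrbitRing)), e', Matrix.mul_apply]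
  refine Ideal.sum_mem _ fun c _ => Ideal.mul_mem_left _ _ ?_
  rw [Matrix.mul_apply]
  exact Ideal.sum_mem _ fun d _ => Ideal.mul_mem_right _ _ (h₀ c d)

end VectorField

end Conifold

namespace Conifold

namespace VectorField

variable (v : VectorField)

/-- The inclusion in `W` of the locus where the nilpotent part does not vanish. -/
def subι : (v.locus : Scheme.{0}) ⟶ W := v.locus.ι ≫ v.toW

theorem subι_comp : v.subι ≫ Wι = v.locus.ι ≫ v.embed :=
  (Category.assoc _ _ _).trans (congrArg (v.locus.ι ≫ ·) v.toW_comp)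

instance : IsImmersion v.subι := inferInstanceAs (IsImmersion (v.locus.ι ≫ v.toW))

theorem subι_str : (v.subι ≫ Wι) ≫ strRep = v.locus.ι ≫ specStr v.OrbitRing := by
  rw [subι_comp, Category.assoc, specMap_str]

theorem prod_condition : pullback.fst strGL ((v.subι ≫ Wι) ≫ strRep) ≫ strGL =
    (pullback.snd strGL ((v.subι ≫ Wι) ≫ strRep) ≫ v.locus.ι) ≫ specStr v.OrbitRing := by
  exact pullback.condition.trans ((congrArg (_ ≫ ·) v.subι_str).trans (Category.assoc _ _ _).symm)

/-- The inclusion of the product of `GL₂` and the locus where the nilpotent part does not vanish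
in the product of `GL₂` and the orbit closure. -/
def prodι : pullback strGL ((v.subι ≫ Wι) ≫ strRep) ⟶ Spec (.of (GLRing ⊗[ℂ] v.OrbitRing)) :=
  pullback.lift (pullback.fst strGL _) (pullback.snd strGL _ ≫ v.locus.ι) v.prod_condition ≫
    (pullbackSpecIso ℂ GLRing v.OrbitRing).hom

instance : IsOpenImmersion v.prodι := by
  have := isOpenImmersion_pullback_lift v.locus.ι v.subι_str.symm v.prod_condition
  exact MorphismProperty.comp_mem (W := @IsOpenImmersion) _ _ this inferInstance

theorem prodι_left : v.prodι ≫ specMap (Algebra.TensorProduct.includeLeft :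
      GLRing →ₐ[ℂ] GLRing ⊗[ℂ] v.OrbitRing) = pullback.fst strGL _ := by
  refine (Category.assoc _ _ _).trans ((congrArg (_ ≫ ·)
    (pullbackSpecIso_hom_fst ℂ GLRing v.OrbitRing)).trans (pullback.lift_fst _ _ _))

theorem prodι_right : v.prodι ≫ specMap (Algebra.TensorProduct.includeRight :
      v.OrbitRing →ₐ[ℂ] GLRing ⊗[ℂ] v.OrbitRing) = pullback.snd strGL _ ≫ v.locus.ι := by
  refine (Category.assoc _ _ _).trans ((congrArg (_ ≫ ·)
    (pullbackSpecIso_hom_snd ℂ GLRing v.OrbitRing)).trans (pullback.lift_snd _ _ _))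

theorem range_prodι_coaction : Set.range (v.prodι ≫ specMap v.orbitCoaction) ⊆
    Set.range v.locus.ι := by
  rintro _ ⟨t, rfl⟩
  rw [Scheme.Opens.range_ι]
  refine v.preimage_locus (v.prodι t) ?_
  have h : specMap (Algebra.TensorProduct.includeRight :
      v.OrbitRing →ₐ[ℂ] GLRing ⊗[ℂ] v.OrbitRing) (v.prodι t) =
      v.locus.ι (pullback.snd strGL _ t) :=
    congrArg (fun k : _ ⟶ Spec (.of v.OrbitRing) => k t) v.prodι_right
  rw [h]
  exact (pullback.snd strGL _ t).2

/-- The restricted action. -/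
def act : pullback strGL ((v.subι ≫ Wι) ≫ strRep) ⟶ v.locus :=
  IsOpenImmersion.lift v.locus.ι (v.prodι ≫ specMap v.orbitCoaction) v.range_prodι_coaction

theorem act_ι : v.act ≫ v.locus.ι = v.prodι ≫ specMap v.orbitCoaction :=
  IsOpenImmersion.lift_fac _ _ _

theorem act_comp : v.act ≫ v.subι ≫ Wι = prodMap (v.subι ≫ Wι) ≫ action := by
  refine (congrArg (v.act ≫ ·) v.subι_comp).trans ((Category.assoc _ _ _).symm.trans
    ((congrArg (· ≫ v.embed) v.act_ι).trans ((Category.assoc _ _ _).trans ?_)))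
  rw [specMap_comp, orbitCoaction_comp,
    ← lift_action _ _ ((specMap_str _).trans (specMap_str _).symm)]
  refine (Category.assoc _ _ _).symm.trans ?_
  refine congrArg (· ≫ action) (pullback.hom_ext ?_ ?_)
  · refine Eq.trans ?_ (prodMap_fst _).symm
    exact (Category.assoc _ _ _).trans ((congrArg (_ ≫ ·) (pullback.lift_fst _ _ _)).trans
      v.prodι_left)
  · refine Eq.trans ?_ (prodMap_snd _).symm
    refine (Category.assoc _ _ _).trans ((congrArg (_ ≫ ·) (pullback.lift_snd _ _ _)).trans ?_)
    rw [← specMap_comp]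
    exact (Category.assoc _ _ _).symm.trans ((congrArg (· ≫ v.embed) v.prodι_right).trans
      ((Category.assoc _ _ _).trans (congrArg (_ ≫ ·) v.subι_comp.symm)))

/-- The locus where the nilpotent part does not vanish, as an invariant subscheme of `W`. -/
def sub : InvariantSubscheme where
  carrier := v.locus
  ι := v.subι
  isImmersion := inferInstance
  act := v.act
  act_comp := v.act_comp

/-- The map of the orbit closure to the conifold. -/
abbrev toY : Spec (.of v.OrbitRing) ⟶ Y := specMap v.center

theorem subι_πW : v.subι ≫ πW = v.locus.ι ≫ v.toY := by
  have : Mono (Spec.map (CommRingCat.ofHom (Ideal.Quotient.mk (Ideal.span {equation})))) :=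
    have := IsClosedImmersion.spec_of_surjective (CommRingCat.ofHom
      (Ideal.Quotient.mk (Ideal.span {equation}))) Ideal.Quotient.mk_surjective
    inferInstance
  rw [← cancel_mono (Spec.map (CommRingCat.ofHom (Ideal.Quotient.mk (Ideal.span {equation})))),
    Category.assoc, πW_comp, ← Category.assoc, subι_comp, Category.assoc, Category.assoc]
  refine congrArg (v.locus.ι ≫ ·) ?_
  rw [traceMap, ← Spec.map_comp, ← Spec.map_comp]
  refine congrArg Spec.map (CommRingCat.hom_ext ?_)
  have h : v.orbitMk.comp halfTraceHom =
      v.center.comp (Ideal.Quotient.mkₐ ℂ (Ideal.span {equation})) := by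
    ext i
    refine Eq.trans ?_ (v.center_z i).symm
    simp [halfTraceHom]
  exact congrArg AlgHom.toRingHom h

theorem act_toY : v.act ≫ v.locus.ι ≫ v.toY = pullback.snd strGL _ ≫ v.locus.ι ≫ v.toY := by
  refine (Category.assoc _ _ _).symm.trans ((congrArg (· ≫ v.toY) v.act_ι).trans (Eq.trans ?_
    ((congrArg (· ≫ v.toY) v.prodι_right).trans (Category.assoc _ _ _))))
  refine (Category.assoc _ _ _).trans (Eq.trans ?_ (Category.assoc _ _ _).symm)
  rw [specMap_comp, specMap_comp]
  have h : v.orbitCoaction.comp v.center =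
      (Algebra.TensorProduct.includeRight : v.OrbitRing →ₐ[ℂ] GLRing ⊗[ℂ] v.OrbitRing).comp
        v.center := AlgHom.ext v.orbitCoaction_center
  rw [h]

end VectorField

end Conifold

namespace Conifold

open BlowUp

/-! ### Algebras over the complex numbers -/

section Chart

variable {I : Ideal CoordRing} (a : I)

instance : Algebra ℂ (Chart a) := ((chartMap a).comp (algebraMap ℂ CoordRing)).toAlgebra

/-- The structure map of the affine blow-up algebra as a map of `ℂ`-algebras. -/
def chartHom : CoordRing →ₐ[ℂ] Chart a := ⟨chartMap a, fun _ => rfl⟩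

theorem chartι_π_eq : chartι a ≫ blowUpπ I = specMap (chartHom a) := chartι_π a

theorem exists_chartHom_lift {S : Type} [CommRing S] [IsDomain S] [Algebra ℂ S]
    (f : CoordRing →ₐ[ℂ] S) (ha : f a ≠ 0) (h : ∀ x ∈ I, f a ∣ f x) :
    ∃ g : Chart a →ₐ[ℂ] S, g.comp (chartHom a) = f := by
  obtain ⟨g, hg⟩ := exists_chart_lift a f.toRingHom ha h
  refine ⟨⟨g, fun c => ?_⟩, AlgHom.ext fun x => congrArg (· x) hg⟩
  exact (congrArg (· (algebraMap ℂ CoordRing c)) hg).trans (f.commutes c)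

end Chart

namespace VectorField

variable (v : VectorField)

theorem conjNil_ne_zero : conjNil 0 1 ≠ 0 := by
  intro h
  let F := ambLift (glLift (1 : Matrix (Fin 2) (Fin 2) CoordRing) (by simp)) (AlgHom.id ℂ CoordRing)
  have h₁ : (univGL.map ambLeft).map F = 1 := by
    have h₂ : F.comp ambLeft = glLift (1 : Matrix (Fin 2) (Fin 2) CoordRing) (by simp) :=
      ambLift_comp_left _ _
    have h₃ := congrArg (fun f : GLRing →ₐ[ℂ] CoordRing => univGL.map f) h₂
    refine Eq.trans ?_ (h₃.trans (univGL_map_glLift _ _))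
    rw [Matrix.map_map]
    rfl
  have h₂ : conjNil.map F = !![0, 1; 0, 0] := by
    have h₃ : ((univGL.map ambLeft)⁻¹).map F = ((univGL.map ambLeft).map F)⁻¹ :=
      map_nonsing_inv F.toRingHom (isUnit_det_map ambLeft)
    rw [conjNil, Matrix.map_mul, Matrix.map_mul, h₃, h₁]
    ext a b; fin_cases a <;> fin_cases b <;> simp
  have := congrFun (congrFun h₂ 0) 1
  rw [Matrix.map_apply, h, map_zero] at this
  exact zero_ne_one this

theorem offDiag_ne_zero {j : Fin 4} (hj : v.coeff j ≠ 0) : v.offDiag j true ≠ 0 := by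
  intro h
  have h' := v.inc_nil j 0 1
  rw [show v.nil j 0 1 = 0 from h, map_zero] at h'
  refine mul_ne_zero ?_ conjNil_ne_zero h'.symm
  exact (map_ne_zero_iff _ ambRight_injective).2 hj

theorem bot_mem_locus : (⊥ : PrimeSpectrum v.OrbitRing) ∈ v.locus :=
  v.mem_locus.2 ⟨0, 0, 1, fun h => v.offDiag_ne_zero v.coeff_zero_ne_zero h⟩

/-- The generic point of the locus where the nilpotent part does not vanish. -/
def genericPt : (v.locus : Scheme.{0}) := ⟨(⊥ : PrimeSpectrum v.OrbitRing), v.bot_mem_locus⟩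

instance : IsIntegral (v.locus : Scheme.{0}) :=
  have : Nonempty (v.locus : Scheme.{0}) := ⟨v.genericPt⟩
  isIntegral_of_isOpenImmersion v.locus.ι

/-! ### The slices -/

/-- The coordinate ring of the locus where an off-diagonal entry of the nilpotent part does not
vanish. -/
def SliceRing (j : Fin 4) (k : Bool) : Type := Localization.Away (v.offDiag j k)

section Slice

variable (j : Fin 4) (k : Bool)

instance : CommRing (v.SliceRing j k) :=
  inferInstanceAs (CommRing (Localization.Away (v.offDiag j k)))

instance : Algebra ℂ (v.SliceRing j k) :=
  inferInstanceAs (Algebra ℂ (Localization.Away (v.offDiag j k)))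

/-- The localization map to the coordinate ring of a slice. -/
def toSlice : v.OrbitRing →ₐ[ℂ] v.SliceRing j k :=
  IsScalarTower.toAlgHom ℂ v.OrbitRing (Localization.Away (v.offDiag j k))

theorem isUnit_toSlice : IsUnit (v.toSlice j k (v.offDiag j k)) :=
  IsLocalization.Away.algebraMap_isUnit (S := Localization.Away (v.offDiag j k)) _

variable {j k}

theorem isDomain_sliceRing (h : v.offDiag j k ≠ 0) : IsDomain (v.SliceRing j k) :=
  IsLocalization.isDomain_localization (powers_le_nonZeroDivisors_of_noZeroDivisors h)

theorem toSlice_injective (h : v.offDiag j k ≠ 0) : Function.Injective (v.toSlice j k) :=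
  IsLocalization.injective (Localization.Away (v.offDiag j k))
    (powers_le_nonZeroDivisors_of_noZeroDivisors h)

instance : IsOpenImmersion (specMap (v.toSlice j k)) :=
  inferInstanceAs (IsOpenImmersion (Spec.map (CommRingCat.ofHom
    (algebraMap v.OrbitRing (Localization.Away (v.offDiag j k))))))

variable (j k)

theorem range_toSlice : Set.range (specMap (v.toSlice j k)) =
    (PrimeSpectrum.basicOpen (v.offDiag j k) : Set (PrimeSpectrum v.OrbitRing)) :=
  PrimeSpectrum.localization_away_comap_range (Localization.Away (v.offDiag j k)) (v.offDiag j k)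

theorem range_toSlice_subset : Set.range (specMap (v.toSlice j k)) ⊆ Set.range v.locus.ι := by
  rw [Scheme.Opens.range_ι, range_toSlice]
  intro x hx
  cases k
  · exact v.mem_locus.2 ⟨j, 1, 0, hx⟩
  · exact v.mem_locus.2 ⟨j, 0, 1, hx⟩

/-- The inclusion of a slice. -/
def sliceι : Spec (.of (v.SliceRing j k)) ⟶ v.locus :=
  IsOpenImmersion.lift v.locus.ι (specMap (v.toSlice j k)) (v.range_toSlice_subset j k)

theorem sliceι_ι : v.sliceι j k ≫ v.locus.ι = specMap (v.toSlice j k) :=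
  IsOpenImmersion.lift_fac _ _ _

instance : IsOpenImmersion (v.sliceι j k) := by
  have : IsOpenImmersion (v.sliceι j k ≫ v.locus.ι) := v.sliceι_ι j k ▸ inferInstance
  exact IsOpenImmersion.of_comp (v.sliceι j k) v.locus.ι

theorem mem_range_sliceι {x : (v.locus : Scheme.{0})} :
    x ∈ (v.sliceι j k).opensRange ↔ v.offDiag j k ∉ (v.locus.ι x).asIdeal := by
  have h : v.locus.ι x ∈ Set.range (specMap (v.toSlice j k)) ↔
      v.offDiag j k ∉ (v.locus.ι x).asIdeal := by
    rw [range_toSlice]; rfl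
  rw [← h]
  constructor
  · rintro ⟨y, rfl⟩
    exact ⟨y, congrArg (fun f : _ ⟶ Spec (.of v.OrbitRing) => f y) (v.sliceι_ι j k).symm⟩
  · rintro ⟨y, hy⟩
    refine ⟨y, v.locus.ι.injective (Eq.trans ?_ hy)⟩
    exact congrArg (fun f : _ ⟶ Spec (.of v.OrbitRing) => f y) (v.sliceι_ι j k)

theorem exists_mem_range_sliceι (x : (v.locus : Scheme.{0})) :
    ∃ p : {p : Fin 4 × Bool // v.offDiag p.1 p.2 ≠ 0},
      x ∈ (v.sliceι p.1.1 p.1.2).opensRange := by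
  suffices h : ∃ i k, v.offDiag i k ∉ (v.locus.ι x).asIdeal by
    obtain ⟨i, k, h⟩ := h
    exact ⟨⟨(i, k), fun h' => h (h' ▸ Ideal.zero_mem _)⟩, (v.mem_range_sliceι i k).2 h⟩
  obtain ⟨i, a, b, h⟩ := v.mem_locus.1 x.2
  by_contra! h'
  have h₁ : v.nil i 0 1 ∈ (v.locus.ι x).asIdeal := h' i true
  have h₂ : v.nil i 1 0 ∈ (v.locus.ι x).asIdeal := h' i false
  have h₃ : v.nil i 0 0 ∈ (v.locus.ι x).asIdeal := by
    refine ((v.locus.ι x).isPrime.mem_or_mem (x := v.nil i 0 0) (y := v.nil i 0 0) ?_).elim id id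
    rw [eq_neg_of_add_eq_zero_left (v.nil_sq i)]
    exact neg_mem (Ideal.mul_mem_right _ _ h₁)
  refine h ?_
  fin_cases a <;> fin_cases b
  · exact h₃
  · exact h₁
  · exact h₂
  · change v.nil i 1 1 ∈ (v.locus.ι x).asIdeal
    rw [nil_one_one]
    exact neg_mem h₃

/-- The cover of the locus where the nilpotent part does not vanish by slices. -/
def sliceCover : (v.locus : Scheme.{0}).OpenCover :=
  .mkOfCovers {p : Fin 4 × Bool // v.offDiag p.1 p.2 ≠ 0} _ (fun p => v.sliceι p.1.1 p.1.2)
    v.exists_mem_range_sliceι inferInstance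

variable {j k}

theorem toSlice_center_ne_zero (h : v.offDiag j k ≠ 0) :
    v.toSlice j k (v.center (v.coeff j)) ≠ 0 :=
  (map_ne_zero_iff _ (v.toSlice_injective h)).2 ((map_ne_zero_iff _ v.center_injective).2
    (v.coeff_ne_zero_of_offDiag h))

theorem exists_sliceHom (h : v.offDiag j k ≠ 0) : ∃ g : Chart (v.gen j) →ₐ[ℂ] v.SliceRing j k,
    g.comp (chartHom (v.gen j)) = (v.toSlice j k).comp v.center := by
  have := v.isDomain_sliceRing h
  refine exists_chartHom_lift _ _ ?_ fun x hx => ?_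
  · exact v.toSlice_center_ne_zero h
  · refine Submodule.span_induction (p := fun x _ => ((v.toSlice j k).comp v.center) (v.gen j) ∣
      ((v.toSlice j k).comp v.center) x) ?_ ?_ ?_ ?_ hx
    · rintro _ ⟨i, rfl⟩
      have h₁ : v.center (v.coeff i) * v.offDiag j k = v.center (v.coeff j) * v.offDiag i k := by
        cases k <;> exact v.center_mul_nil _ _ _ _
      have h₂ := congrArg (v.toSlice j k) h₁
      rw [map_mul, map_mul] at h₂
      exact ((v.isUnit_toSlice j k).dvd_mul_right).1 ⟨_, h₂⟩
    · rw [map_zero]; exact dvd_zero _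
    · intro x y _ _ hx hy
      rw [map_add]; exact dvd_add hx hy
    · intro r x _ hx
      rw [smul_eq_mul, map_mul]; exact hx.mul_left _

/-- The map of a slice to the corresponding chart of the blow-up. -/
def sliceHom (h : v.offDiag j k ≠ 0) : Chart (v.gen j) →ₐ[ℂ] v.SliceRing j k :=
  (v.exists_sliceHom h).choose

theorem sliceHom_comp (h : v.offDiag j k ≠ 0) :
    (v.sliceHom h).comp (chartHom (v.gen j)) = (v.toSlice j k).comp v.center :=
  (v.exists_sliceHom h).choose_spec

/-- The fraction `eᵢ / eⱼ` of coefficients of the vector field. -/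
def ratio (j i : Fin 4) : Chart (v.gen j) :=
  frac (v.gen j) 1 (v.coeff i) (by rw [pow_one]; exact (v.gen i).2)

theorem ratio_mul (j i : Fin 4) :
    v.ratio j i * chartHom (v.gen j) (v.coeff j) = chartHom (v.gen j) (v.coeff i) :=
  frac_one_mul _

theorem sliceHom_ratio_mul (h : v.offDiag j k ≠ 0) (i : Fin 4) (a b : Fin 2) :
    v.sliceHom h (v.ratio j i) * v.toSlice j k (v.nil j a b) = v.toSlice j k (v.nil i a b) := by
  have := v.isDomain_sliceRing h
  have hc (x : CoordRing) : v.sliceHom h (chartHom (v.gen j) x) = v.toSlice j k (v.center x) :=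
    congrArg (· x) (v.sliceHom_comp h)
  have h₁ := congrArg (v.sliceHom h) (v.ratio_mul j i)
  have h₂ := congrArg (v.toSlice j k) (v.center_mul_nil i j a b)
  rw [map_mul, hc, hc] at h₁
  rw [map_mul, map_mul] at h₂
  have h₃ : v.toSlice j k (v.center (v.coeff j)) ≠ 0 :=
    v.toSlice_center_ne_zero h
  refine mul_left_cancel₀ h₃ ?_
  rw [h₂, ← h₁]
  ring

end Slice

end VectorField

end Conifold

namespace Conifold

open BlowUp

namespace VectorField

variable (v : VectorField)

/-! ### The morphism to the blow-up -/

theorem nonempty_preimage : ((v.locus.ι ≫ v.toY) ⁻¹ᵁ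
    PrimeSpectrum.basicOpen (v.gen 0 : CoordRing) : Set (v.locus : Scheme.{0})).Nonempty := by
  refine ⟨v.genericPt, ?_⟩
  change v.center (v.coeff 0) ∉ (⊥ : PrimeSpectrum v.OrbitRing).asIdeal
  exact (map_ne_zero_iff _ v.center_injective).2 v.coeff_zero_ne_zero

theorem exists_quot : ∃ q : (v.locus : Scheme.{0}) ⟶ blowUp v.ideal,
    q ≫ blowUpπ v.ideal = v.locus.ι ≫ v.toY ∧ ∀ {j : Fin 4} {k : Bool} (h : v.offDiag j k ≠ 0),
      v.sliceι j k ≫ q = specMap (v.sliceHom h) ≫ chartι (v.gen j) := by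
  obtain ⟨q, hq, hq'⟩ := exists_lift (v.locus.ι ≫ v.toY) (v.gen 0) v.nonempty_preimage v.sliceCover
    (fun p => specMap (v.sliceHom p.2) ≫ chartι (v.gen p.1.1)) (fun p => by
      refine (Category.assoc _ _ _).trans ((congrArg (_ ≫ ·) (chartι_π_eq _)).trans
        ((specMap_comp _ _).trans ?_))
      refine Eq.trans ?_ (Category.assoc (v.sliceι p.1.1 p.1.2) v.locus.ι v.toY)
      rw [sliceHom_comp, ← specMap_comp, ← sliceι_ι])
  exact ⟨q, hq, fun {j k} h => hq' ⟨(j, k), h⟩⟩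

/-- The morphism to the blow-up of the zero locus of the vector field. -/
def quot : (v.locus : Scheme.{0}) ⟶ blowUp v.ideal := v.exists_quot.choose

theorem quot_π : v.quot ≫ blowUpπ v.ideal = v.locus.ι ≫ v.toY := v.exists_quot.choose_spec.1

theorem sliceι_quot {j : Fin 4} {k : Bool} (h : v.offDiag j k ≠ 0) :
    v.sliceι j k ≫ v.quot = specMap (v.sliceHom h) ≫ chartι (v.gen j) :=
  v.exists_quot.choose_spec.2 h

theorem act_quot : v.act ≫ v.quot = pullback.snd strGL ((v.subι ≫ Wι) ≫ strRep) ≫ v.quot := by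
  let e : (v.locus : Scheme.{0}) ⟶ GL₂ := (v.locus.ι ≫ specStr v.OrbitRing) ≫
    specMap (glLift (1 : Matrix (Fin 2) (Fin 2) ℂ) (by simp))
  have he : e ≫ strGL = 𝟙 (v.locus : Scheme.{0}) ≫ (v.subι ≫ Wι) ≫ strRep := by
    refine (Category.assoc _ _ _).trans ?_
    rw [specMap_str, Category.id_comp, subι_str]
    refine Eq.trans (congrArg (_ ≫ ·) ?_) (Category.comp_id _)
    exact Spec.map_id _
  let t := pullback.lift e (𝟙 _) he v.genericPt
  have ht : pullback.snd strGL ((v.subι ≫ Wι) ≫ strRep) t = v.genericPt :=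
    congrArg (fun f : (v.locus : Scheme.{0}) ⟶ v.locus => f v.genericPt)
      (pullback.lift_snd e (𝟙 _) he)
  have : Nonempty (pullback strGL ((v.subι ≫ Wι) ≫ strRep) : Scheme.{0}) := ⟨t⟩
  have : IsIntegral (pullback strGL ((v.subι ≫ Wι) ≫ strRep) : Scheme.{0}) :=
    isIntegral_of_isOpenImmersion v.prodι
  refine lift_unique (pullback.snd strGL ((v.subι ≫ Wι) ≫ strRep) ≫ v.locus.ι ≫ v.toY) (v.gen 0) ?_
    (𝟙 _) ?_ ?_
  · refine ⟨t, ?_⟩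
    have h : v.center (v.coeff 0) ∉
        (v.locus.ι (pullback.snd strGL ((v.subι ≫ Wι) ≫ strRep) t)).asIdeal := by
      rw [ht]
      exact (map_ne_zero_iff _ v.center_injective).2 v.coeff_zero_ne_zero
    exact h
  · exact (Category.assoc _ _ _).trans ((congrArg (_ ≫ ·) v.quot_π).trans
      (v.act_toY.trans (Category.id_comp _).symm))
  · exact (Category.assoc _ _ _).trans ((congrArg (_ ≫ ·) v.quot_π).trans
      (Category.id_comp _).symm)

/-! ### The sections over the charts -/

theorem chartHom_coeff_ne_zero {j : Fin 4} (hj : v.coeff j ≠ 0) :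
    chartHom (v.gen j) (v.coeff j) ≠ 0 :=
  (map_ne_zero_iff _ (chartMap_injective (a := v.gen j) hj)).2 hj

theorem ratio_tangent {j : Fin 4} (hj : v.coeff j ≠ 0) :
    chartHom (v.gen j) (z 0) * v.ratio j 1 + v.ratio j 0 * chartHom (v.gen j) (z 1) =
      chartHom (v.gen j) (z 2) * v.ratio j 3 + v.ratio j 2 * chartHom (v.gen j) (z 3) := by
  have := chart_isDomain (a := v.gen j) hj
  refine mul_right_cancel₀ (v.chartHom_coeff_ne_zero hj) ?_
  have h := congrArg (chartHom (v.gen j)) v.tangent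
  simp only [map_add, map_mul] at h
  linear_combination h + chartHom (v.gen j) (z 0) * v.ratio_mul j 1 +
    chartHom (v.gen j) (z 1) * v.ratio_mul j 0 - chartHom (v.gen j) (z 2) * v.ratio_mul j 3 -
    chartHom (v.gen j) (z 3) * v.ratio_mul j 2

/-- The family of representations `zᵢ + (eᵢ / eⱼ) [0, 1; 0, 0]` over a chart. -/
def chartRep {j : Fin 4} (hj : v.coeff j ≠ 0) : RepRing →ₐ[ℂ] Chart (v.gen j) :=
  utHom (fun i => chartHom (v.gen j) (z i)) (v.ratio j)
    (by rw [← map_mul, ← map_mul, z_equation]) (v.ratio_tangent hj)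

variable {j : Fin 4}

theorem univ_map_chartRep {j : Fin 4} (hj : v.coeff j ≠ 0) (i : Fin 4) :
    (univ i).map (v.chartRep hj) =
      !![chartHom (v.gen j) (z i), v.ratio j i; 0, chartHom (v.gen j) (z i)] :=
  univ_map_utHom _ _ _ _ i

theorem chartRep_eq_zero (hj : v.coeff j ≠ 0) (x : RepRing) (hx : v.orbitHom x = 0) :
    v.chartRep hj x = 0 := by
  have := chart_isDomain (a := v.gen j) hj
  let K := FractionRing (Chart (v.gen j))
  let f : Chart (v.gen j) →ₐ[ℂ] K := IsScalarTower.toAlgHom ℂ _ _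
  have hf : Function.Injective f := IsFractionRing.injective _ K
  let e := f (chartHom (v.gen j) (v.coeff j))
  have he : e ≠ 0 := (map_ne_zero_iff _ hf).2 (v.chartHom_coeff_ne_zero hj)
  let γ : GLRing →ₐ[ℂ] K := glLift !![e⁻¹, 0; 0, 1] (by
    rw [Matrix.det_fin_two_of, mul_one, mul_zero, sub_zero]
    exact isUnit_iff_ne_zero.2 (inv_ne_zero he))
  have h : f.comp (v.chartRep hj) =
      (ambLift γ (f.comp (chartHom (v.gen j)))).comp v.orbitHom := by
    rw [orbitHom, map_conjHom, ambLift_comp_left, ← AlgHom.comp_assoc, ambLift_comp_right]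
    symm
    rw [conjHom_eq_iff]
    intro i
    rw [univGL_map_glLift, chartRep, secHom, map_utHom, map_utHom, univ_map_utHom, univ_map_utHom]
    have hi : f (v.ratio j i) * e = f (chartHom (v.gen j) (v.coeff i)) := by
      rw [← v.ratio_mul j i, map_mul]
    have h₁ : e⁻¹ * f (chartHom (v.gen j) (v.coeff i)) = f (v.ratio j i) := by
      rw [← hi, mul_comm, mul_assoc, mul_inv_cancel₀ he, mul_one]
    simp only [AlgHom.comp_apply, Matrix.mul_fin_two, zero_mul, mul_zero, add_zero, zero_add, h₁,
      mul_one, one_mul, mul_comm e⁻¹]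
  apply hf
  refine (congrArg (· x) h).trans ?_
  change ambLift _ _ (v.orbitHom x) = _
  rw [hx, map_zero, map_zero]

/-- The family of representations over a chart, as a point of the orbit closure. -/
def chartPt (hj : v.coeff j ≠ 0) : v.OrbitRing →ₐ[ℂ] Chart (v.gen j) :=
  v.orbitLift (v.chartRep hj) (v.chartRep_eq_zero hj)

theorem chartPt_comp (hj : v.coeff j ≠ 0) : (v.chartPt hj).comp v.orbitMk = v.chartRep hj :=
  v.orbitLift_comp _ _

theorem chartPt_center (hj : v.coeff j ≠ 0) : (v.chartPt hj).comp v.center = chartHom (v.gen j) :=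
  coordHom_ext fun i => by
    rw [AlgHom.comp_apply, center_z, ← AlgHom.comp_apply, chartPt_comp, chartRep, utHom_halfTrace]

theorem ratio_self (hj : v.coeff j ≠ 0) : v.ratio j j = 1 := by
  have := chart_isDomain (a := v.gen j) hj
  refine mul_right_cancel₀ (v.chartHom_coeff_ne_zero hj) ?_
  exact (v.ratio_mul j j).trans (one_mul _).symm

theorem chartPt_offDiag (hj : v.coeff j ≠ 0) : v.chartPt hj (v.offDiag j true) = 1 := by
  have h₁ : v.chartRep hj (univ j 0 1) = v.ratio j j :=
    congrFun (congrFun (v.univ_map_chartRep hj j) 0) 1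
  have h₂ : v.offDiag j true = v.orbitMk (univ j 0 1) := by
    rw [offDiag, nil, Matrix.sub_apply, Matrix.scalar_apply, Matrix.diagonal_apply_ne _ zero_ne_one,
      sub_zero, Matrix.map_apply]
  rw [← v.ratio_self hj, ← h₁, ← v.chartPt_comp hj, h₂]
  rfl

theorem range_chartPt_subset (hj : v.coeff j ≠ 0) :
    Set.range (specMap (v.chartPt hj)) ⊆ Set.range v.locus.ι := by
  rw [Scheme.Opens.range_ι]
  rintro _ ⟨x, rfl⟩
  refine v.mem_locus.2 ⟨j, 0, 1, fun h => ?_⟩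
  have h' : v.chartPt hj (v.offDiag j true) ∈ PrimeSpectrum.asIdeal x := h
  rw [chartPt_offDiag] at h'
  exact (PrimeSpectrum.isPrime x).ne_top ((Ideal.eq_top_iff_one _).2 h')

/-- The section over a chart. -/
def sec (hj : v.coeff j ≠ 0) : Spec (.of (Chart (v.gen j))) ⟶ v.locus :=
  IsOpenImmersion.lift v.locus.ι (specMap (v.chartPt hj)) (v.range_chartPt_subset hj)

theorem sec_ι (hj : v.coeff j ≠ 0) : v.sec hj ≫ v.locus.ι = specMap (v.chartPt hj) :=
  IsOpenImmersion.lift_fac _ _ _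

theorem sec_quot (hj : v.coeff j ≠ 0) : v.sec hj ≫ v.quot = chartι (v.gen j) := by
  have := chart_isDomain (a := v.gen j) hj
  refine lift_unique (specMap (chartHom (v.gen j))) (v.gen j) ?_ (𝟙 _) ?_ ?_
  · have h : chartHom (v.gen j) (v.coeff j) ∉ (⊥ : PrimeSpectrum (Chart (v.gen j))).asIdeal := by
      rw [PrimeSpectrum.asIdeal_bot, Ideal.mem_bot]
      exact v.chartHom_coeff_ne_zero hj
    have h' : specMap (chartHom (v.gen j)) (⊥ : PrimeSpectrum (Chart (v.gen j))) ∈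
        PrimeSpectrum.basicOpen (v.coeff j) := h
    exact ⟨_, h'⟩
  · rw [Category.assoc, quot_π, ← Category.assoc, sec_ι, specMap_comp, chartPt_center,
      Category.id_comp]
  · rw [chartι_π_eq, Category.id_comp]

/-! ### The geometric quotient -/

theorem exists_slice {x : (v.locus : Scheme.{0})} (hx : v.quot x ∈ (chartι (v.gen j)).opensRange) :
    ∃ k, x ∈ (v.sliceι j k).opensRange := by
  obtain ⟨⟨⟨i, k⟩, h⟩, y, rfl⟩ := v.exists_mem_range_sliceι x
  refine ⟨k, (v.mem_range_sliceι j k).2 ?_⟩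
  have h₁ : v.quot (v.sliceι i k y) = chartι (v.gen i) (specMap (v.sliceHom h) y) :=
    congrArg (fun f : _ ⟶ blowUp v.ideal => f y) (v.sliceι_quot h)
  have h₂ : v.locus.ι (v.sliceι i k y) = specMap (v.toSlice i k) y :=
    congrArg (fun f : _ ⟶ Spec (.of v.OrbitRing) => f y) (v.sliceι_ι i k)
  rw [h₁] at hx
  change specMap (v.sliceHom h) y ∈ chartι (v.gen i) ⁻¹ᵁ (chartι (v.gen j)).opensRange at hx
  rw [chartι_preimage_opensRange] at hx
  change v.sliceHom h (v.ratio i j) ∉ PrimeSpectrum.asIdeal y at hx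
  rw [h₂]
  change ¬ v.toSlice i k (v.offDiag j k) ∈ PrimeSpectrum.asIdeal y
  have h₃ : v.sliceHom h (v.ratio i j) * v.toSlice i k (v.offDiag i k) =
      v.toSlice i k (v.offDiag j k) := by
    cases k <;> exact v.sliceHom_ratio_mul h _ _ _
  rw [← h₃]
  intro hmem
  obtain hmem | hmem := (PrimeSpectrum.isPrime y).mem_or_mem hmem
  · exact hx hmem
  · exact (PrimeSpectrum.isPrime y).ne_top (Ideal.eq_top_of_isUnit_mem _ hmem
      (v.isUnit_toSlice i k))

theorem exists_conj_slice (hj : v.coeff j ≠ 0) {k : Bool} (h : v.offDiag j k ≠ 0) :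
    ∃ γ : GLRing →ₐ[ℂ] v.SliceRing j k, conjHom γ ((v.sliceHom h).comp (v.chartRep hj)) =
      (v.toSlice j k).comp v.orbitMk := by
  obtain ⟨M, hM, hM'⟩ := exists_conj_of_isUnit (x := v.toSlice j k (v.nil j 0 0))
    (y := v.toSlice j k (v.nil j 0 1)) (w := v.toSlice j k (v.nil j 1 0))
    (by rw [← map_mul, ← map_mul, ← map_add, nil_sq, map_zero])
    (by cases k; exacts [Or.inr (v.isUnit_toSlice j _), Or.inl (v.isUnit_toSlice j _)])
  refine ⟨glLift M hM, conjHom_eq_iff.2 fun i => ?_⟩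
  have hN : !![v.toSlice j k (v.nil j 0 0), v.toSlice j k (v.nil j 0 1);
      v.toSlice j k (v.nil j 1 0), -v.toSlice j k (v.nil j 0 0)] =
      (v.nil j).map (v.toSlice j k) := by
    ext a b; fin_cases a <;> fin_cases b <;> simp [nil_one_one]
  have h₁ : (univ i).map ((v.toSlice j k).comp v.orbitMk) =
      Matrix.scalar (Fin 2) (v.toSlice j k (v.center (z i))) +
        v.sliceHom h (v.ratio j i) • (v.nil j).map (v.toSlice j k) := by
    ext a b
    rw [Matrix.add_apply, Matrix.smul_apply, Matrix.map_apply, Matrix.map_apply, smul_eq_mul,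
      sliceHom_ratio_mul, nil, Matrix.sub_apply, map_sub, Matrix.scalar_apply, Matrix.scalar_apply]
    by_cases hab : a = b <;> simp [hab]
  have h₂ : (univ i).map ((v.sliceHom h).comp (v.chartRep hj)) =
      Matrix.scalar (Fin 2) (v.toSlice j k (v.center (z i))) +
        v.sliceHom h (v.ratio j i) • !![0, 1; 0, 0] := by
    have hz : v.sliceHom h (chartHom (v.gen j) (z i)) = v.toSlice j k (v.center (z i)) :=
      congrArg (· (z i)) (v.sliceHom_comp h)
    rw [chartRep, map_utHom, univ_map_utHom, ← hz]
    ext a b; fin_cases a <;> fin_cases b <;> simp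
  rw [univGL_map_glLift, h₁, h₂, Matrix.mul_add, Matrix.add_mul,
    ← Matrix.scalar_comm _ (Commute.all _), Matrix.mul_smul, Matrix.smul_mul, hM', hN]

theorem lift_act {T : Scheme.{0}} (a : T ⟶ GL₂) (t : T ⟶ v.locus)
    (w : a ≫ strGL = t ≫ (v.subι ≫ Wι) ≫ strRep) :
    (pullback.lift a t w ≫ v.act) ≫ v.subι ≫ Wι =
      pullback.lift a (t ≫ v.subι ≫ Wι) (w.trans (Category.assoc _ _ _).symm) ≫ action :=
  (Category.assoc _ _ _).trans ((congrArg (_ ≫ ·) v.act_comp).trans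
    (lift_prodMap_action _ a t w))

instance : Mono (v.subι ≫ Wι) := by
  rw [subι_comp]; infer_instance

theorem lift_act_eq {A : Type} [CommRing A] [Algebra ℂ A] (γ : GLRing →ₐ[ℂ] A)
    (t t' : Spec (.of A) ⟶ v.locus) (m m' : RepRing →ₐ[ℂ] A) (ht : t ≫ v.subι ≫ Wι = specMap m)
    (ht' : t' ≫ v.subι ≫ Wι = specMap m') (h : conjHom γ m = m')
    (w : specMap γ ≫ strGL = t ≫ (v.subι ≫ Wι) ≫ strRep) :
    pullback.lift (specMap γ) t w ≫ v.act = t' := by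
  rw [← cancel_mono (v.subι ≫ Wι), lift_act, ht', ← h,
    ← lift_action _ _ ((specMap_str _).trans (specMap_str _).symm)]
  congr 2

end VectorField

end Conifold

namespace Conifold

open BlowUp

namespace VectorField

variable (v : VectorField)

theorem lift_act_sub {A : Type} [CommRing A] [Algebra ℂ A] (γ : GLRing →ₐ[ℂ] A)
    (t : Spec (.of A) ⟶ v.locus) (m : RepRing →ₐ[ℂ] A) (ht : t ≫ v.subι ≫ Wι = specMap m)
    (w : specMap γ ≫ strGL = t ≫ (v.subι ≫ Wι) ≫ strRep) :
    (pullback.lift (specMap γ) t w ≫ v.act) ≫ v.subι ≫ Wι = specMap (conjHom γ m) := by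
  rw [lift_act, ← lift_action _ _ ((specMap_str _).trans (specMap_str _).symm)]
  congr 2

theorem transitive {A : Type} [CommRing A] (a b : Spec (.of A) ⟶ GL₂)
    (t : Spec (.of A) ⟶ v.locus) (wa : a ≫ strGL = t ≫ (v.subι ≫ Wι) ≫ strRep)
    (wb : b ≫ strGL = t ≫ (v.subι ≫ Wι) ≫ strRep) : ∃ (c : Spec (.of A) ⟶ GL₂)
      (wc : c ≫ strGL = (pullback.lift a t wa ≫ v.act) ≫ (v.subι ≫ Wι) ≫ strRep),
      pullback.lift c (pullback.lift a t wa ≫ v.act) wc ≫ v.act = pullback.lift b t wb ≫ v.act := by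
  let : Algebra ℂ A := (Spec.preimage (t ≫ (v.subι ≫ Wι) ≫ strRep)).hom.toAlgebra
  have hs : specStr A = t ≫ (v.subι ≫ Wι) ≫ strRep := Spec.map_preimage _
  obtain ⟨α, rfl⟩ := exists_eq_specMap a (wa.trans hs.symm)
  obtain ⟨β, rfl⟩ := exists_eq_specMap b (wb.trans hs.symm)
  obtain ⟨m, hm⟩ := exists_eq_specMap (t ≫ v.subι ≫ Wι) ((Category.assoc _ _ _).trans hs.symm)
  have hα := v.lift_act_sub α t m hm wa
  have hβ := v.lift_act_sub β t m hm wb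
  refine ⟨specMap (glMul β (glInv α)), ?_, v.lift_act_eq _ _ _ _ _ hα hβ ?_ _⟩
  · refine (specMap_str _).trans (((congrArg (· ≫ strRep) hα).trans (specMap_str _)).symm.trans ?_)
    exact Category.assoc _ _ _
  · rw [conjHom_conjHom, glMul_glInv_cancel]

theorem isGeometricQuotient : IsGeometricQuotient strGL ((v.sub.ι ≫ Wι) ≫ strRep)
    (blowUpπ v.ideal ≫ strY) v.sub.act v.quot := by
  have hsec {j : Fin 4} (hj : v.coeff j ≠ 0) : v.sec hj ≫ v.subι ≫ Wι =
      specMap (v.chartRep hj) := by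
    rw [subι_comp, ← Category.assoc, sec_ι, specMap_comp, chartPt_comp]
  refine IsGeometricQuotient.of_local_sections ?_ v.act_quot
    (fun j : {j // v.coeff j ≠ 0} => chartι (v.gen j)) (exists_mem_range_chartι v.span_gen)
    (fun j => v.sec j.2) (fun j => v.sec_quot j.2) ?_ fun K _ => v.transitive
  · refine (Category.assoc _ _ _).symm.trans ((congrArg (· ≫ strY) v.quot_π).trans ?_)
    refine (Category.assoc _ _ _).trans (Eq.trans ?_ v.subι_str.symm)
    exact congrArg (_ ≫ ·) (specMap_str _)
  · rintro ⟨j, hj⟩ p hp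
    obtain ⟨k, hk⟩ := v.exists_slice hp
    have h : v.offDiag j k ≠ 0 := fun h =>
      (v.mem_range_sliceι j k).1 hk (h ▸ Ideal.zero_mem _)
    obtain ⟨γ, hγ⟩ := v.exists_conj_slice hj h
    have hr : (specMap (v.sliceHom h) ≫ v.sec hj) ≫ v.subι ≫ Wι =
        specMap ((v.sliceHom h).comp (v.chartRep hj)) := by
      rw [Category.assoc, hsec, specMap_comp]
    have ho : v.sliceι j k ≫ v.subι ≫ Wι = specMap ((v.toSlice j k).comp v.orbitMk) := by
      rw [subι_comp, ← Category.assoc, sliceι_ι, specMap_comp]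
    have hi : IsOpenImmersion (v.sliceι j k) := inferInstance
    refine ⟨_, v.sliceι j k, hi, specMap (v.sliceHom h), specMap γ, ?_, hk,
      v.lift_act_eq γ _ _ _ _ hr ho hγ _⟩
    refine (specMap_str _).trans (((congrArg (· ≫ strRep) hr).trans (specMap_str _)).symm.trans ?_)
    exact Category.assoc _ _ _

theorem epi_quot : Epi v.quot :=
  epi_of_local_sections v.quot (fun j : {j // v.coeff j ≠ 0} => chartι (v.gen j))
    (exists_mem_range_chartι v.span_gen) (fun j => v.sec j.2) (fun j => v.sec_quot j.2)

theorem exists_invariantSubscheme {I : Ideal CoordRing} (hI : v.ideal = I) :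
    ∃ (Z : InvariantSubscheme) (q : Z.carrier ⟶ blowUp I),
      IsGeometricQuotient strGL ((Z.ι ≫ Wι) ≫ strRep) (blowUpπ I ≫ strY) Z.act q ∧
      ∀ d : blowUp I ⟶ Y, q ≫ d = Z.ι ≫ πW ↔ d = blowUpπ I := by
  subst hI
  have := v.epi_quot
  have h : v.quot ≫ blowUpπ v.ideal = v.subι ≫ πW := v.quot_π.trans v.subι_πW.symm
  refine ⟨v.sub, v.quot, v.isGeometricQuotient, fun d => ⟨fun hd => ?_, fun hd => hd ▸ h⟩⟩
  exact (cancel_epi v.quot).1 (hd.trans h.symm)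

theorem isIntegral_blowUp : IsIntegral (blowUp v.ideal) := by
  have hq := v.isGeometricQuotient
  have hs : Function.Surjective v.quot := hq.surjective.surj
  have : Nonempty (blowUp v.ideal) := ⟨v.quot v.genericPt⟩
  have : IsReduced v.sub.carrier := inferInstanceAs (IsReduced (v.locus : Scheme.{0}))
  have : IsReduced (blowUp v.ideal) := ⟨fun U =>
    isReduced_of_injective _ (hq.functions_injective U)⟩
  have : IrreducibleSpace (blowUp v.ideal) :=
    Function.Surjective.irreducibleSpace v.quot.continuous hs
  exact isIntegral_of_irreducibleSpace_of_isReduced _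

end VectorField

end Conifold

namespace Conifold

open BlowUp

namespace VectorField

theorem exists_unique_lift (v : VectorField) {I J : Ideal CoordRing} (hI : v.ideal = I)
    (h : ∀ j, v.coeff j ≠ 0 → ∃ s ∈ J, s ≠ 0 ∧
      ∀ x ∈ J, chartHom (v.gen j) s ∣ chartHom (v.gen j) x) :
    ∃ f : blowUp I ⟶ blowUp J, ∀ g : blowUp I ⟶ blowUp J,
      g ≫ blowUpπ J = blowUpπ I ↔ g = f := by
  subst hI
  have hv := v.isIntegral_blowUp
  let 𝒰 : (blowUp v.ideal).OpenCover := .mkOfCovers {j // v.coeff j ≠ 0} _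
    (fun j => chartι (v.gen j)) (exists_mem_range_chartι v.span_gen) inferInstance
  have hg (j : {j // v.coeff j ≠ 0}) : ∃ g : Spec (.of (Chart (v.gen j))) ⟶ blowUp J,
      g ≫ blowUpπ J = chartι (v.gen j) ≫ blowUpπ v.ideal := by
    have := chart_isDomain (a := v.gen j) j.2
    obtain ⟨s, hs, hs₀, hd⟩ := h j j.2
    obtain ⟨g, hg⟩ := exists_chartHom_lift ⟨s, hs⟩ (chartHom (v.gen j))
      ((map_ne_zero_iff _ (chartMap_injective (a := v.gen j) j.2)).2 hs₀) hd
    refine ⟨specMap g ≫ chartι ⟨s, hs⟩, ?_⟩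
    rw [Category.assoc, chartι_π_eq, chartι_π_eq, specMap_comp, hg]
  choose g hg using hg
  obtain ⟨a, ha, ha₀, -⟩ := h 0 v.coeff_zero_ne_zero
  have hne : (blowUpπ v.ideal ⁻¹ᵁ PrimeSpectrum.basicOpen ((⟨a, ha⟩ : J) : CoordRing) :
      Set (blowUp v.ideal)).Nonempty := by
    have := chart_isDomain (a := v.gen 0) v.coeff_zero_ne_zero
    refine ⟨chartι (v.gen 0) (⊥ : PrimeSpectrum (Chart (v.gen 0))), ?_⟩
    have h₁ : blowUpπ v.ideal (chartι (v.gen 0) (⊥ : PrimeSpectrum (Chart (v.gen 0)))) =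
        specMap (chartHom (v.gen 0)) (⊥ : PrimeSpectrum (Chart (v.gen 0))) :=
      congrArg (fun f : Spec (.of (Chart (v.gen 0))) ⟶ Y => f (⊥ : PrimeSpectrum (Chart (v.gen 0))))
        (chartι_π_eq (v.gen 0))
    have h₂ : chartHom (v.gen 0) a ∉ (⊥ : PrimeSpectrum (Chart (v.gen 0))).asIdeal := by
      rw [PrimeSpectrum.asIdeal_bot, Ideal.mem_bot]
      exact (map_ne_zero_iff _ (chartMap_injective (a := v.gen 0) v.coeff_zero_ne_zero)).2 ha₀
    change blowUpπ v.ideal _ ∈ PrimeSpectrum.basicOpen a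
    rw [h₁]
    exact h₂
  obtain ⟨f, hf, -⟩ := exists_lift (blowUpπ v.ideal) ⟨a, ha⟩ hne 𝒰 g hg
  refine ⟨f, fun g => ⟨fun hg => ?_, fun hg => hg ▸ hf⟩⟩
  exact lift_unique (blowUpπ v.ideal) ⟨a, ha⟩ hne (𝟙 _) (hg.trans (Category.id_comp _).symm)
    (hf.trans (Category.id_comp _).symm)

/-- The Euler vector field. -/
def euler : VectorField where
  coeff := z
  tangent := by rw [z_equation]
  coeff_zero_ne_zero := z_ne_zero 0

/-- The vector field `z₁ ∂₁ + z₃ ∂₃`. -/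
def plus : VectorField where
  coeff := ![z 0, 0, z 2, 0]
  tangent := by simp [z_equation]
  coeff_zero_ne_zero := z_ne_zero 0

/-- The vector field `z₁ ∂₁ + z₄ ∂₄`. -/
def minus : VectorField where
  coeff := ![z 0, 0, 0, z 3]
  tangent := by simp [z_equation]
  coeff_zero_ne_zero := z_ne_zero 0

theorem euler_ideal : euler.ideal = Ideal.span {z 0, z 1, z 2, z 3} := by
  rw [ideal]
  congr 1
  ext x
  simp [euler, Fin.exists_fin_succ, eq_comm]

theorem plus_ideal : plus.ideal = Ideal.span {z 0, z 2} := by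
  refine le_antisymm (Ideal.span_le.2 ?_) (Ideal.span_le.2 ?_)
  · rintro _ ⟨i, rfl⟩
    fin_cases i
    · exact Ideal.subset_span (by simp [plus])
    · exact Ideal.zero_mem _
    · exact Ideal.subset_span (by simp [plus])
    · exact Ideal.zero_mem _
  · rintro _ (rfl | rfl)
    · exact Ideal.subset_span ⟨0, rfl⟩
    · exact Ideal.subset_span ⟨2, rfl⟩

theorem minus_ideal : minus.ideal = Ideal.span {z 0, z 3} := by
  refine le_antisymm (Ideal.span_le.2 ?_) (Ideal.span_le.2 ?_)
  · rintro _ ⟨i, rfl⟩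
    fin_cases i
    · exact Ideal.subset_span (by simp [minus])
    · exact Ideal.zero_mem _
    · exact Ideal.zero_mem _
    · exact Ideal.subset_span (by simp [minus])
  · rintro _ (rfl | rfl)
    · exact Ideal.subset_span ⟨0, rfl⟩
    · exact Ideal.subset_span ⟨3, rfl⟩

/-- On each chart of `Ỹ`, the ideals of the centers of `Y₊` and `Y₋` are principal. -/
theorem exists_dvd_of_euler {p q : Fin 4} (h : z 0 * z 1 = z p * z q)
    (hpq : ∀ j, j = 0 ∨ j = 1 ∨ j = p ∨ j = q) (j : Fin 4) :
    ∃ s ∈ Ideal.span {z 0, z p}, s ≠ 0 ∧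
      ∀ x ∈ Ideal.span {z 0, z p}, chartHom (euler.gen j) s ∣ chartHom (euler.gen j) x := by
  have := chart_isDomain (a := euler.gen j) (z_ne_zero j)
  let F := chartHom (euler.gen j)
  have hF : F (z j) ≠ 0 := euler.chartHom_coeff_ne_zero (z_ne_zero j)
  have hr (i : Fin 4) : euler.ratio j i * F (z j) = F (z i) := euler.ratio_mul j i
  have h' : F (z 0) * F (z 1) = F (z p) * F (z q) := by rw [← map_mul, h, map_mul]
  have hdvd {s : CoordRing} (h₀ : F s ∣ F (z 0)) (hp : F s ∣ F (z p)) :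
      ∀ x ∈ Ideal.span {z 0, z p}, F s ∣ F x := fun x hx => by
    obtain ⟨a, b, rfl⟩ := Ideal.mem_span_pair.1 hx
    rw [map_add, map_mul, map_mul]
    exact dvd_add (h₀.mul_left _) (hp.mul_left _)
  have m₀ : z 0 ∈ Ideal.span {z 0, z p} := Ideal.subset_span (by simp)
  have mp : z p ∈ Ideal.span {z 0, z p} := Ideal.subset_span (by simp)
  obtain hj | hj | hj | hj := hpq j
  · refine ⟨z 0, m₀, z_ne_zero 0, hdvd dvd_rfl ⟨euler.ratio j p, ?_⟩⟩
    rw [← hr p, ← hj, mul_comm]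
  · refine ⟨z p, mp, z_ne_zero p, hdvd ⟨euler.ratio j q, mul_right_cancel₀ hF ?_⟩ dvd_rfl⟩
    rw [mul_assoc, hr, ← h']
    exact congrArg (fun i => F (z 0) * F (z i)) hj
  · refine ⟨z p, mp, z_ne_zero p, hdvd ⟨euler.ratio j 0, ?_⟩ dvd_rfl⟩
    rw [← hr 0, ← hj, mul_comm]
  · refine ⟨z 0, m₀, z_ne_zero 0, hdvd dvd_rfl ⟨euler.ratio j 1, mul_right_cancel₀ hF ?_⟩⟩
    rw [mul_assoc, hr, h']
    exact congrArg (fun i => F (z p) * F (z i)) hj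

end VectorField

end Conifold

end

open Conifold in
theorem lemma3p1 :
    -- invariant subschemes `Ỹ'`, `Y₊'`, `Y₋'` of `W`, and their quotients
    ∃ (Zt Zp Zm : InvariantSubscheme)
      (Qt Qp Qm : Scheme.{0})
      (qt : Zt.carrier ⟶ Qt) (qp : Zp.carrier ⟶ Qp) (qm : Zm.carrier ⟶ Qm)
      -- the morphisms to `Y` to which `π^W` descends
      (dt : Qt ⟶ Y) (dp : Qp ⟶ Y) (dm : Qm ⟶ Y)
      -- the isomorphisms of the quotients with the resolutions
      (et : Qt ≅ Yt) (ep : Qp ≅ Yp) (em : Qm ≅ Ym)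
      -- the morphisms `f₊`, `f₋` of the resolution diagram
      (fp : Yt ⟶ Yp) (fm : Yt ⟶ Ym),
      -- geometric quotients
      IsGeometricQuotient strGL ((Zt.ι ≫ Wι) ≫ strRep) (dt ≫ strY) Zt.act qt ∧
      IsGeometricQuotient strGL ((Zp.ι ≫ Wι) ≫ strRep) (dp ≫ strY) Zp.act qp ∧
      IsGeometricQuotient strGL ((Zm.ι ≫ Wι) ≫ strRep) (dm ≫ strY) Zm.act qm ∧
      -- the restriction of `π^W` descends, uniquely, to `dt`, `dp`, `dm`
      (∀ d : Qt ⟶ Y, qt ≫ d = Zt.ι ≫ πW ↔ d = dt) ∧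
      (∀ d : Qp ⟶ Y, qp ≫ d = Zp.ι ≫ πW ↔ d = dp) ∧
      (∀ d : Qm ⟶ Y, qm ≫ d = Zm.ι ≫ πW ↔ d = dm) ∧
      -- the descended morphisms are `π`, `π₊`, `π₋` under the isomorphisms
      et.hom ≫ πt = dt ∧ ep.hom ≫ πp = dp ∧ em.hom ≫ πm = dm ∧
      -- `f₊`, `f₋` are the unique morphisms over `Y`
      (∀ f : Yt ⟶ Yp, f ≫ πp = πt ↔ f = fp) ∧
      (∀ f : Yt ⟶ Ym, f ≫ πm = πt ↔ f = fm) ∧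
      -- the quotients form the same diagram over `Y`
      (et.hom ≫ fp ≫ ep.inv) ≫ dp = dt ∧
      (et.hom ≫ fm ≫ em.inv) ≫ dm = dt := by

  obtain ⟨Zt, qt, ht, hdt⟩ := VectorField.euler.exists_invariantSubscheme VectorField.euler_ideal
  obtain ⟨Zp, qp, hp, hdp⟩ := VectorField.plus.exists_invariantSubscheme VectorField.plus_ideal
  obtain ⟨Zm, qm, hm, hdm⟩ := VectorField.minus.exists_invariantSubscheme VectorField.minus_ideal
  obtain ⟨fp, hfp⟩ := VectorField.euler.exists_unique_lift (J := Ideal.span {z 0, z 2})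
    VectorField.euler_ideal fun j _ =>
      VectorField.exists_dvd_of_euler (q := 3) z_equation (by decide) j
  obtain ⟨fm, hfm⟩ := VectorField.euler.exists_unique_lift (J := Ideal.span {z 0, z 3})
    VectorField.euler_ideal fun j _ =>
      VectorField.exists_dvd_of_euler (q := 2) (z_equation.trans (mul_comm _ _)) (by decide) j
  refine ⟨Zt, Zp, Zm, Yt, Yp, Ym, qt, qp, qm, πt, πp, πm, Iso.refl _, Iso.refl _, Iso.refl _,
    fp, fm, ht, hp, hm, hdt, hdp, hdm, Category.id_comp _, Category.id_comp _, Category.id_comp _, hfp, hfm,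
    ?_, ?_⟩
  · simpa using (hfp fp).2 rfl
  · simpa using (hfm fm).2 rfl
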